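/- For a finite graph $G$ and $M\subseteq V(G)$, two vertices $u,v\in M$ are $M$-visible if $G$ contains a shortest $u,v$-path that passes through no vertex of $M\setminus\{u,v\}$. The set $M$ is a mutual-visibility set of $G$ if its vertices are pairwise $M$-visible, and $\mu(G)$ denotes the size of a largest mutual-visibility set of $G$. Let $C_n$ denote the cycle on $n$ vertices and $\Box$ the Cartesian product of graphs. Theorem. Let $s$ and $t$ be integers with $t\ge 14$ or $t=12$. If $s\ge t$, then $\mu(C_s\,\Box\,C_t)=3t$. -/

import Mathlib

open SimpleGraph

/-- Vertices `u` and `v` are `M`-visible in `G`: there is a shortest `u,v`-path of `G`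
containing no vertex of `M` other than possibly `u` and `v`. -/
def MVisible {V : Type*} (G : SimpleGraph V) (M : Set V) (u v : V) : Prop :=
  ∃ p : G.Walk u v, p.IsPath ∧ p.length = G.dist u v ∧
    ∀ w ∈ p.support, w ∈ M → w = u ∨ w = v

/-- `M` is a mutual-visibility set of `G`: its vertices are pairwise `M`-visible. -/
def IsMutualVisibilitySet {V : Type*} (G : SimpleGraph V) (M : Set V) : Prop :=
  ∀ u ∈ M, ∀ v ∈ M, MVisible G M u v

/-- The mutual-visibility number `μ(G)` of a graph `G` on a finite vertex set:
the size of a largest mutual-visibility set of `G`. -/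
noncomputable def mutualVisibilityNumber {V : Type*} [Finite V] (G : SimpleGraph V) : ℕ :=
  sSup {n : ℕ | ∃ M : Set V, IsMutualVisibilitySet G M ∧ M.ncard = n}

/-! Upper bound. A shortest path between two vertices of one copy of `C_s` stays in that copy. If
such a copy contained four points of `M`, the second and fourth in cyclic order would block both
arcs between the first and third. So each of the `t` copies holds at most three points
(`ncard_le_of_isMutualVisibilitySet`).

Lower bound. Lift to the integer lattice. Two vertices span a rectangle with sides at most `s/2` and
`t/2`, and every monotone staircase across it is a geodesic. If points on a common line are more
than a quarter of the period apart and no two are diagonally adjacent (`IsSpread`), then a staircase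
avoiding all other points exists. A greedy path from one corner reaches the opposite horizontal
side, a greedy path from the other corner reaches the opposite vertical side, and the two must meet
(`exists_staircase`, `IsSpread.isMutualVisibilitySet`).

It remains to find spread sets with three points in every row. Stretching the first cycle preserves
spreadness when the base rows have a little slack, so one base set serves all large `s`
(`IsSpreadBase.isSpread`). For most `t` the base is a union of three cosets of a line `x = c * y` in
the `t` by `t` torus, about `t/3` apart (`affineSet_isSpreadBase`). For the remaining small `t` it
is an explicit table. For a few pairs `(s, t)` a table is used whose visibility is verified
directly, by searching for staircases (`isMutualVisibilitySet_tableSet`). -/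

/-- The residue of an integer as a vertex of a cycle. -/
def cycleVertex (n : ℕ) [NeZero n] (x : ℤ) : Fin n :=
  ⟨(x % n).toNat, by
    have hn : (0 : ℤ) < n := by exact_mod_cast Nat.pos_of_neZero n
    have := Int.emod_nonneg x hn.ne'
    have := Int.emod_lt_of_pos x hn
    omega⟩

/-- A short signed displacement is minimal among the congruent ones. -/
theorem le_abs_of_modEq {n : ℕ} {d e : ℤ} (h : e ≡ d [ZMOD n]) (hd : 2 * |d| ≤ n) : |d| ≤ |e| := by
  obtain ⟨k, hk⟩ := h.dvd
  rcases eq_or_ne k 0 with rfl | hk0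
  · have : d = e := by linarith
    rw [this]
  · have h1 : (n : ℤ) ≤ |d - e| := by
      rw [hk, abs_mul, abs_of_nonneg (by positivity : (0 : ℤ) ≤ n)]
      have := Int.one_le_abs hk0
      nlinarith [(by positivity : (0 : ℤ) ≤ n)]
    have := abs_sub d e
    linarith

/-! ### Cycles as integers modulo `n` -/

section cycle
variable {n : ℕ} [NeZero n]

theorem cycleVertex_val (x : ℤ) : ((cycleVertex n x).val : ℤ) = x % n := by
  have hn : (0 : ℤ) < n := by exact_mod_cast Nat.pos_of_neZero n
  exact Int.toNat_of_nonneg (Int.emod_nonneg x hn.ne')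

theorem cycleVertex_eq_iff {x y : ℤ} : cycleVertex n x = cycleVertex n y ↔ x ≡ y [ZMOD n] := by
  rw [Fin.ext_iff, ← Nat.cast_inj (R := ℤ), cycleVertex_val, cycleVertex_val]
  rfl

theorem cycleVertex_coe (u : Fin n) : cycleVertex n (u.val : ℤ) = u := by
  rw [Fin.ext_iff, ← Nat.cast_inj (R := ℤ), cycleVertex_val]
  exact Int.emod_eq_of_lt (by positivity) (by exact_mod_cast u.isLt)

theorem cycleGraph_adj_iff_val {n : ℕ} {u v : Fin n} (hn : 3 ≤ n) :
    (cycleGraph n).Adj u v ↔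
      (v.val : ℤ) = u.val + 1 ∨ (u.val : ℤ) = v.val + 1 ∨
      ((v.val : ℤ) = 0 ∧ (u.val : ℤ) = n - 1) ∨ ((u.val : ℤ) = 0 ∧ (v.val : ℤ) = n - 1) := by
  rw [cycleGraph_adj']
  have hu := u.isLt
  have hv := v.isLt
  have : NeZero n := ⟨by omega⟩
  rcases le_total u v with h | h
  · rcases h.eq_or_lt with rfl | h'
    · rw [Fin.coe_sub_iff_le.2 le_rfl]; omega
    · rw [Fin.coe_sub_iff_lt.2 h', Fin.coe_sub_iff_le.2 h]
      have : u.val < v.val := h'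
      omega
  · rcases h.eq_or_lt with rfl | h'
    · rw [Fin.coe_sub_iff_le.2 le_rfl]; omega
    · rw [Fin.coe_sub_iff_lt.2 h', Fin.coe_sub_iff_le.2 h]
      have : v.val < u.val := h'
      omega

theorem cycleGraph_adj_displacement {n : ℕ} {u v : Fin n} (hn : 3 ≤ n) (h : (cycleGraph n).Adj u v) :
    ∃ e : ℤ, |e| ≤ 1 ∧ (v.val : ℤ) ≡ u.val + e [ZMOD n] := by
  rw [cycleGraph_adj_iff_val hn] at h
  rcases h with h | h | h | h
  · exact ⟨1, by simp, by rw [h]⟩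
  · exact ⟨-1, by simp, by rw [h]; simp [Int.ModEq]⟩
  · refine ⟨1, by simp, ?_⟩
    rw [h.1, h.2]; simp [Int.ModEq]
  · refine ⟨-1, by simp, ?_⟩
    rw [h.1, h.2, Int.modEq_iff_dvd]; exact ⟨-1, by ring⟩

theorem cycleGraph_adj_cycleVertex (hn : 3 ≤ n) (x : ℤ) :
    (cycleGraph n).Adj (cycleVertex n x) (cycleVertex n (x + 1)) := by
  rw [cycleGraph_adj_iff_val hn, cycleVertex_val, cycleVertex_val]
  have hn' : (3 : ℤ) ≤ n := by exact_mod_cast hn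
  have h0 := Int.emod_nonneg x (by omega : (n : ℤ) ≠ 0)
  have h1 := Int.emod_lt_of_pos x (by omega : (0 : ℤ) < n)
  have h2 : (x + 1) % (n : ℤ) = (x % n + 1) % n := by simp
  rw [h2]
  rcases lt_or_eq_of_le (show x % n + 1 ≤ n by omega) with h | h
  · rw [Int.emod_eq_of_lt (by omega) h]; omega
  · rw [h, Int.emod_self]; omega

theorem cycleGraph_adj_cycleVertex_unit (hn : 3 ≤ n) (x : ℤ) {σ : ℤ} (hσ : σ = 1 ∨ σ = -1) :
    (cycleGraph n).Adj (cycleVertex n x) (cycleVertex n (x + σ)) := by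
  rcases hσ with rfl | rfl
  · exact cycleGraph_adj_cycleVertex hn x
  · have := (cycleGraph_adj_cycleVertex hn (x + -1)).symm
    simpa using this

end cycle

/-! ### Distances and geodesics in the toroidal grid -/

section torus
variable {s t : ℕ} [NeZero s] [NeZero t]

/-- The vertex of the toroidal grid below a point of the integer lattice. -/
def torusVertex (s t : ℕ) [NeZero s] [NeZero t] (x y : ℤ) : Fin s × Fin t :=
  (cycleVertex s x, cycleVertex t y)

theorem torusVertex_coe (u : Fin s × Fin t) : torusVertex s t u.1.val u.2.val = u :=
  Prod.ext (cycleVertex_coe _) (cycleVertex_coe _)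

/-- Lifting a walk to the lattice, each step moves one coordinate by at most one. This bounds walk
lengths from below by the size of a displacement in the right residue classes. -/
theorem exists_displacement_of_walk {s t : ℕ} (hs : 3 ≤ s) (ht : 3 ≤ t) {u v : Fin s × Fin t}
    (w : (cycleGraph s □ cycleGraph t).Walk u v) :
    ∃ dx dy : ℤ, |dx| + |dy| ≤ w.length ∧
      (v.1.val : ℤ) ≡ u.1.val + dx [ZMOD s] ∧ (v.2.val : ℤ) ≡ u.2.val + dy [ZMOD t] := by
  induction w with
  | nil => exact ⟨0, 0, by simp, by simp, by simp⟩
  | cons h w ih =>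
    obtain ⟨dx, dy, hd, hx, hy⟩ := ih
    rw [boxProd_adj] at h
    rcases h with ⟨h, h2⟩ | ⟨h, h2⟩
    · obtain ⟨e, he, hm⟩ := cycleGraph_adj_displacement hs h
      refine ⟨e + dx, dy, ?_, ?_, by rw [h2]; exact hy⟩
      · have := abs_add_le e dx
        rw [Walk.length_cons]; push_cast; linarith
      · refine hx.trans ?_
        rw [← add_assoc]; exact hm.add_right _
    · obtain ⟨e, he, hm⟩ := cycleGraph_adj_displacement ht h
      refine ⟨dx, e + dy, ?_, by rw [h2]; exact hx, ?_⟩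
      · have := abs_add_le e dy
        rw [Walk.length_cons]; push_cast; linarith
      · refine hy.trans ?_
        rw [← add_assoc]; exact hm.add_right _

theorem le_length_of_walk (hs : 3 ≤ s) (ht : 3 ≤ t) {x y a b : ℤ}
    (ha : 2 * |a| ≤ s) (hb : 2 * |b| ≤ t)
    (w : (cycleGraph s □ cycleGraph t).Walk (torusVertex s t x y)
      (torusVertex s t (x + a) (y + b))) :
    |a| + |b| ≤ w.length := by
  obtain ⟨dx, dy, hd, hx, hy⟩ := exists_displacement_of_walk hs ht w
  simp only [torusVertex, cycleVertex_val] at hx hy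
  have hx' : dx ≡ a [ZMOD s] := by
    have h1 : x + a ≡ x + dx [ZMOD s] := by
      refine (Int.mod_modEq _ _).symm.trans (hx.trans ?_)
      exact (Int.mod_modEq _ _).add_right _
    exact (Int.ModEq.add_left_cancel' _ h1).symm
  have hy' : dy ≡ b [ZMOD t] := by
    have h1 : y + b ≡ y + dy [ZMOD t] := by
      refine (Int.mod_modEq _ _).symm.trans (hy.trans ?_)
      exact (Int.mod_modEq _ _).add_right _
    exact (Int.ModEq.add_left_cancel' _ h1).symm
  have := le_abs_of_modEq hx' ha
  have := le_abs_of_modEq hy' hb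
  linarith

/-- A staircase of the integer lattice, given by its height on each antidiagonal, projects to a
walk of the toroidal grid. -/
theorem exists_walk_of_staircase (hs : 3 ≤ s) (ht : 3 ≤ t) (x y : ℤ) {σ τ : ℤ}
    (hσ : σ = 1 ∨ σ = -1) (hτ : τ = 1 ∨ τ = -1) (h : ℕ → ℕ) (h0 : h 0 = 0) (N : ℕ)
    (hstep : ∀ n < N, h (n + 1) = h n ∨ h (n + 1) = h n + 1) :
    ∃ w : (cycleGraph s □ cycleGraph t).Walk (torusVertex s t x y)
        (torusVertex s t (x + σ * (N - h N)) (y + τ * h N)),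
      w.length = N ∧ ∀ z ∈ w.support, ∃ n ≤ N,
        z = torusVertex s t (x + σ * (n - h n)) (y + τ * h n) := by
  induction N with
  | zero =>
    refine ⟨(Walk.nil : (cycleGraph s □ cycleGraph t).Walk (torusVertex s t x y) _).copy rfl
      (by simp [h0]), by simp, ?_⟩
    intro z hz
    simp only [Walk.support_copy, Walk.support_nil, List.mem_singleton] at hz
    exact ⟨0, le_rfl, by simp [h0, hz]⟩
  | succ N ih =>
    obtain ⟨w, hw, hsup⟩ := ih fun n hn => hstep n (by omega)
    have hadj : (cycleGraph s □ cycleGraph t).Adj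
        (torusVertex s t (x + σ * (N - h N)) (y + τ * h N))
        (torusVertex s t (x + σ * ((N + 1 : ℕ) - h (N + 1))) (y + τ * h (N + 1))) := by
      rw [boxProd_adj]
      rcases hstep N (by omega) with e | e
      · left
        refine ⟨?_, by simp [torusVertex, e]⟩
        have := cycleGraph_adj_cycleVertex_unit hs (x + σ * (N - h N)) hσ
        simp only [torusVertex, e]
        convert this using 2
        push_cast; ring
      · right
        refine ⟨?_, by simp [torusVertex, e]⟩
        have := cycleGraph_adj_cycleVertex_unit ht (y + τ * h N) hτ
        simp only [torusVertex, e]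
        convert this using 2
        push_cast; ring
    refine ⟨w.concat hadj, by simp [hw], ?_⟩
    intro z hz
    rw [Walk.support_concat, List.mem_append, List.mem_singleton] at hz
    rcases hz with hz | rfl
    · obtain ⟨n, hn, rfl⟩ := hsup z hz
      exact ⟨n, by omega, rfl⟩
    · exact ⟨N + 1, le_rfl, rfl⟩

/-- Since `p` and `q` are at most half the periods, no walk can be shorter than `p + q`, so the
projected staircase is a geodesic. Visibility becomes a question about obstacles in a planar
rectangle. -/
theorem mVisible_of_staircase (hs : 3 ≤ s) (ht : 3 ≤ t) {M : Set (Fin s × Fin t)} (x y : ℤ)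
    {σ τ : ℤ} (hσ : σ = 1 ∨ σ = -1) (hτ : τ = 1 ∨ τ = -1) {p q : ℕ} (hp : 2 * p ≤ s)
    (hq : 2 * q ≤ t) (h : ℕ → ℕ) (h0 : h 0 = 0) (hend : h (p + q) = q)
    (hstep : ∀ n < p + q, h (n + 1) = h n ∨ h (n + 1) = h n + 1)
    (hfree : ∀ n, 0 < n → n < p + q →
      torusVertex s t (x + σ * (n - h n)) (y + τ * h n) ∉ M) :
    MVisible (cycleGraph s □ cycleGraph t) M (torusVertex s t x y)
      (torusVertex s t (x + σ * p) (y + τ * q)) := by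
  obtain ⟨w, hw, hsup⟩ := exists_walk_of_staircase hs ht x y hσ hτ h h0 (p + q) hstep
  have e : torusVertex s t (x + σ * ((p + q : ℕ) - h (p + q))) (y + τ * h (p + q)) =
      torusVertex s t (x + σ * p) (y + τ * q) := by
    rw [hend]; push_cast; congr 1; ring
  have habs : ∀ {ρ : ℤ} (k : ℕ), (ρ = 1 ∨ ρ = -1) → |ρ * k| = k := by
    rintro ρ k (rfl | rfl) <;> simp
  have hdist : (w.copy rfl e).length =
      (cycleGraph s □ cycleGraph t).dist (torusVertex s t x y)
        (torusVertex s t (x + σ * p) (y + τ * q)) := by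
    refine le_antisymm ?_ (dist_le _)
    obtain ⟨w', hw'⟩ := (Walk.reachable (w.copy rfl e)).exists_walk_length_eq_dist
    rw [← hw', Walk.length_copy, hw]
    have := le_length_of_walk hs ht (a := σ * p) (b := τ * q)
      (by rw [habs p hσ]; exact_mod_cast hp) (by rw [habs q hτ]; exact_mod_cast hq) w'
    rw [habs p hσ, habs q hτ] at this
    exact_mod_cast this
  refine ⟨w.copy rfl e, Walk.isPath_of_length_eq_dist _ hdist, hdist, ?_⟩
  intro z hz hzM
  rw [Walk.support_copy] at hz
  obtain ⟨n, hn, rfl⟩ := hsup z hz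
  rcases Nat.eq_zero_or_pos n with rfl | hn0
  · left; simp [h0]
  · rcases hn.eq_or_lt with rfl | hn1
    · right; exact e
    · exact absurd hzM (hfree n hn0 hn1)

/-- Any two vertices of the toroidal grid span a rectangle of at most half the size. -/
theorem exists_short_displacement {n : ℕ} [NeZero n] (u v : Fin n) :
    ∃ σ : ℤ, (σ = 1 ∨ σ = -1) ∧ ∃ p : ℕ, 2 * p ≤ n ∧ v = cycleVertex n (u.val + σ * p) := by
  have hu := u.isLt
  have hv := v.isLt
  have key : ∀ (σ : ℤ) (p : ℕ) (k : ℤ), (u.val : ℤ) + σ * p = v.val + n * k →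
      v = cycleVertex n (u.val + σ * p) := by
    intro σ p k h
    rw [h, ← cycleVertex_coe v, cycleVertex_eq_iff, cycleVertex_coe, Int.modEq_iff_dvd]
    exact ⟨k, by ring⟩
  rcases le_total u.val v.val with h | h
  · rcases le_total (2 * (v.val - u.val)) n with h2 | h2
    · exact ⟨1, Or.inl rfl, v.val - u.val, h2, key _ _ 0 (by push_cast [h]; ring)⟩
    · refine ⟨-1, Or.inr rfl, n - (v.val - u.val), by omega, key _ _ (-1) ?_⟩
      rw [Nat.cast_sub (by omega), Nat.cast_sub h]; ring
  · rcases le_total (2 * (u.val - v.val)) n with h2 | h2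
    · exact ⟨-1, Or.inr rfl, u.val - v.val, h2, key _ _ 0 (by push_cast [h]; ring)⟩
    · refine ⟨1, Or.inl rfl, n - (u.val - v.val), by omega, key _ _ 1 ?_⟩
      rw [Nat.cast_sub (by omega), Nat.cast_sub h]; ring

end torus

/-! ### Staircases avoiding obstacles in a rectangle -/

/-- The northernmost staircase from the origin that avoids `O`, turning east only below an
obstacle or in row `q`: its height on each antidiagonal. -/
def northStaircase (O : ℕ → ℕ → Prop) [∀ x y, Decidable (O x y)] (q : ℕ) : ℕ → ℕ
  | 0 => 0
  | n + 1 =>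
    if northStaircase O q n < q ∧ ¬ O (n - northStaircase O q n) (northStaircase O q n + 1) then
      northStaircase O q n + 1
    else northStaircase O q n

/-- If no two obstacles are adjacent along an antidiagonal, and every obstacle of the first column
lies above every obstacle of the last column, then some staircase avoiding the obstacles leads from
the bottom left corner of a rectangle to its top row. -/
theorem exists_staircase_to_top {O : ℕ → ℕ → Prop} {p q : ℕ} (h00 : ¬ O 0 0)
    (hanti : ∀ x y, O (x + 1) y → ¬ O x (y + 1))
    (hcol : ∀ b c, O 0 b → O p c → c < b) :
    ∃ (f : ℕ → ℕ) (N : ℕ), f 0 = 0 ∧ f N = q ∧ N ≤ p + q ∧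
      (∀ n < N, f (n + 1) = f n ∨ f (n + 1) = f n + 1) ∧
      ∀ n ≤ N, f n ≤ n ∧ f n ≤ q ∧ n - f n ≤ p ∧ ¬ O (n - f n) (f n) := by
  classical
  set f := northStaircase O q with hf
  have f0 : f 0 = 0 := rfl
  have fstep : ∀ n, f (n + 1) =
      if f n < q ∧ ¬ O (n - f n) (f n + 1) then f n + 1 else f n := fun n => rfl
  have step : ∀ n, f (n + 1) = f n ∨ f (n + 1) = f n + 1 := by
    intro n; rw [fstep]; split_ifs <;> simp
  have le_self : ∀ n, f n ≤ n := by
    intro n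
    induction n with
    | zero => simp [f0]
    | succ n ih => rcases step n with h | h <;> omega
  have le_q : ∀ n, f n ≤ q := by
    intro n
    induction n with
    | zero => simp [f0]
    | succ n ih => rw [fstep]; split_ifs with h <;> omega
  -- while below row `q`, the staircase is free and stays in the rectangle
  have main : ∀ n, (∀ m < n, f m < q) → n - f n ≤ p ∧ ¬ O (n - f n) (f n) ∧
      -- The first column is left only below an obstacle. Remembering that obstacle lets `hcol`
      -- exclude being blocked in the last column.
      (0 < n - f n → ∃ b ≤ f n + 1, O 0 b) := by
    intro n
    induction n with
    | zero => intro _; simp [f0, h00]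
    | succ n ih =>
      intro hlt
      obtain ⟨h1, h2, h3⟩ := ih fun m hm => hlt m (by omega)
      have hn := hlt n (by omega)
      have hle := le_self n
      by_cases hO : O (n - f n) (f n + 1)
      · have e : f (n + 1) = f n := by rw [fstep, if_neg (by simp [hO])]
        rw [e, Nat.succ_sub hle]
        refine ⟨?_, fun h => hanti _ _ h hO, fun _ => ?_⟩
        · by_contra hcon
          have hp : n - f n = p := by omega
          rcases Nat.eq_zero_or_pos (n - f n) with h | h
          · have h' := hO
            rw [hp] at hO
            rw [h] at h'
            exact lt_irrefl _ (hcol _ _ h' hO)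
          · obtain ⟨b, hb, hb'⟩ := h3 h
            rw [hp] at hO
            have := hcol _ _ hb' hO
            omega
        · rcases Nat.eq_zero_or_pos (n - f n) with h | h
          · exact ⟨f n + 1, le_rfl, by rwa [h] at hO⟩
          · exact h3 h
      · have e : f (n + 1) = f n + 1 := by rw [fstep, if_pos ⟨hn, hO⟩]
        rw [e, Nat.add_sub_add_right]
        exact ⟨h1, hO, fun h => by obtain ⟨b, hb, hb'⟩ := h3 h; exact ⟨b, by omega, hb'⟩⟩
  -- A path still below row `q` after `p + q` steps would have gone more than `p` steps east.
  have hex : ∃ N, f N = q := by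
    by_contra hcon
    push Not at hcon
    have hlt : ∀ m, f m < q := fun m => lt_of_le_of_ne (le_q m) (hcon m)
    have := (main (p + q) fun m _ => hlt m).1
    have := hlt (p + q)
    omega
  classical
  have hmin : ∀ m < Nat.find hex, f m < q := fun m hm =>
    lt_of_le_of_ne (le_q m) (Nat.find_min hex hm)
  have hN := Nat.find_spec hex
  refine ⟨f, Nat.find hex, f0, hN, ?_, fun n _ => step n, ?_⟩
  · have := (main _ hmin).1
    omega
  · intro n hn
    obtain ⟨h1, h2, -⟩ := main n fun m hm => hmin m (by omega)
    exact ⟨le_self n, le_q n, h1, h2⟩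

/-- A discrete intermediate value theorem for two staircases. -/
theorem exists_eq_of_unit_steps {f g : ℕ → ℕ} {a b : ℕ} (hab : a ≤ b) (ha : f a ≤ g a)
    (hb : g b ≤ f b) (hf : ∀ n, a ≤ n → n < b → f (n + 1) = f n ∨ f (n + 1) = f n + 1)
    (hg : ∀ n, a ≤ n → n < b → g (n + 1) = g n ∨ g (n + 1) = g n + 1) :
    ∃ m, a ≤ m ∧ m ≤ b ∧ f m = g m := by
  induction b, hab using Nat.le_induction with
  | base => exact ⟨a, le_rfl, le_rfl, by omega⟩
  | succ b hab ih =>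
    by_cases h : g b ≤ f b
    · obtain ⟨m, h1, h2, h3⟩ := ih h (fun n h1 h2 => hf n h1 (by omega))
        fun n h1 h2 => hg n h1 (by omega)
      exact ⟨m, h1, by omega, h3⟩
    · refine ⟨b + 1, by omega, le_rfl, ?_⟩
      rcases hf b hab (by omega) with e | e <;> rcases hg b hab (by omega) with e' | e' <;> omega

/-- A rectangle can be crossed by a staircase avoiding the obstacles if no two obstacles are
adjacent along an antidiagonal, every obstacle of the first column lies above every obstacle of the
last one, and every obstacle of the bottom row lies to the right of every obstacle of the top
row. -/
theorem exists_staircase {O : ℕ → ℕ → Prop} {p q : ℕ} (h00 : ¬ O 0 0) (hpq : ¬ O p q)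
    (hanti : ∀ x y, O (x + 1) y → ¬ O x (y + 1))
    (hcol : ∀ b c, O 0 b → O p c → c < b) (hrow : ∀ a c, O a 0 → O c q → c < a) :
    ∃ h : ℕ → ℕ, h 0 = 0 ∧ h (p + q) = q ∧
      (∀ n < p + q, h (n + 1) = h n ∨ h (n + 1) = h n + 1) ∧
      ∀ n ≤ p + q, ¬ O (n - h n) (h n) := by
  obtain ⟨f, N, f0, fN, hN, fstep, ff⟩ := exists_staircase_to_top (q := q) h00 hanti hcol
  -- Reversing and transposing the rectangle turns the greedy path into one that starts at `(p, q)`,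
  -- prefers west, and ends in the first column. Here `hrow` plays the role of `hcol`.
  obtain ⟨g, K, g0, gK, hK, gstep, gf⟩ := exists_staircase_to_top
    (O := fun X Y => X ≤ q ∧ Y ≤ p ∧ O (p - Y) (q - X)) (p := q) (q := p)
    (by simpa using hpq)
    (by
      rintro x y ⟨h1, h2, h3⟩ ⟨h4, h5, h6⟩
      refine hanti (p - (y + 1)) (q - (x + 1)) ?_ ?_
      · rwa [show p - (y + 1) + 1 = p - y by omega]
      · rwa [show q - (x + 1) + 1 = q - x by omega])
    (by
      rintro b c ⟨h1, h2, h3⟩ ⟨h4, h5, h6⟩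
      have := hrow _ _ (by simpa using h6) (by simpa using h3)
      omega)
  -- the second staircase, as a function of the first antidiagonal index
  set G : ℕ → ℕ := fun m => q + g (p + q - m) - (p + q - m) with hG
  have hKN : p + q - K ≤ N := by
    have := (gf K le_rfl).1
    have := (ff N le_rfl).1
    omega
  have Gstep : ∀ n, p + q - K ≤ n → n < p + q → G (n + 1) = G n ∨ G (n + 1) = G n + 1 := by
    intro n h1 h2
    have h3 := gstep (p + q - (n + 1)) (by omega)
    rw [show p + q - (n + 1) + 1 = p + q - n by omega] at h3
    have h4 := gf (p + q - (n + 1)) (by omega)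
    have h5 := gf (p + q - n) (by omega)
    simp only [hG]
    rcases h3 with h3 | h3 <;> omega
  -- On antidiagonal `p + q - K` the second path is in column 0, hence not below the first. On
  -- antidiagonal `N` the first is in row `q`, hence not below the second. Switching paths where
  -- they meet gives the crossing.
  obtain ⟨m, hm1, hm2, hm⟩ := exists_eq_of_unit_steps (f := f) (g := G) hKN
    (by
      have h1 := ff (p + q - K) hKN
      have h2 := gf K le_rfl
      simp only [hG]
      rw [show p + q - (p + q - K) = K by omega]
      omega)
    (by
      have h2 := gf (p + q - N) (by omega)
      simp only [hG]
      omega)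
    (fun n _ h => fstep n h) (fun n h1 h2 => Gstep n h1 (by omega))
  refine ⟨fun n => if n ≤ m then f n else G n, by simp [f0], ?_, ?_, ?_⟩
  · by_cases h : p + q ≤ m
    · have : p + q = N := by omega
      simp only [h, if_true]; rw [this, fN]
    · simp only [h, if_false, hG]
      simp [g0]
  · intro n hn
    by_cases h : n + 1 ≤ m
    · simp only [h, show n ≤ m by omega, if_true]
      exact fstep n (by omega)
    · by_cases h' : n ≤ m
      · have : n = m := by omega
        subst this
        simp only [h, le_refl, if_true, if_false, hm]
        exact Gstep _ hm1 hn
      · simp only [h, h', if_false]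
        exact Gstep n (by omega) hn
  · intro n hn
    by_cases h : n ≤ m
    · simp only [h, if_true]
      exact (ff n (by omega)).2.2.2
    · simp only [h, if_false]
      have h2 := gf (p + q - n) (by omega)
      have e1 : p - g (p + q - n) = n - G n := by simp only [hG]; omega
      have e2 : q - (p + q - n - g (p + q - n)) = G n := by simp only [hG]; omega
      rw [← e1, ← e2]
      exact fun hO => h2.2.2.2 ⟨h2.2.2.1, h2.2.1, hO⟩

/-! ### Spread sets are mutual-visibility sets -/

/-- A doubly periodic set of lattice points in which any two points on a common line are more than
a quarter of the period apart, and no two points are diagonally adjacent. -/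
structure IsSpread (s t : ℕ) (P : ℤ → ℤ → Prop) : Prop where
  of_modEq : ∀ {x x' y y' : ℤ}, x ≡ x' [ZMOD s] → y ≡ y' [ZMOD t] → P x y → P x' y'
  row : ∀ {x y d : ℤ}, 0 < d → P x y → P (x + d) y → s < 4 * d
  col : ∀ {x y d : ℤ}, 0 < d → P x y → P x (y + d) → t < 4 * d
  diag : ∀ {x y : ℤ}, P x y → ¬ P (x + 1) (y + 1)
  antidiag : ∀ {x y : ℤ}, P x (y + 1) → ¬ P (x + 1) y

/-- The vertices of the toroidal grid given by a doubly periodic set of lattice points. -/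
def latticeSet (s t : ℕ) (P : ℤ → ℤ → Prop) : Set (Fin s × Fin t) :=
  {v | P v.1.val v.2.val}

section
variable {s t : ℕ} [NeZero s] [NeZero t] {P : ℤ → ℤ → Prop}

theorem torusVertex_mem_latticeSet
    (hP : ∀ {x x' y y' : ℤ}, x ≡ x' [ZMOD s] → y ≡ y' [ZMOD t] → P x y → P x' y') {x y : ℤ} :
    torusVertex s t x y ∈ latticeSet s t P ↔ P x y := by
  simp only [latticeSet, torusVertex, Set.mem_ofPred_eq, cycleVertex_val]
  exact ⟨hP (Int.mod_modEq _ _) (Int.mod_modEq _ _),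
    hP (Int.mod_modEq _ _).symm (Int.mod_modEq _ _).symm⟩

/-- An obstacle in the column of `u` is more than `t/4` from `u`, and one in the column of `v` is
more than `t/4` from `v`. As `q ≤ t/2`, the former lies strictly higher, as `exists_staircase`
demands. Rows are alike, and the diagonal conditions keep obstacles from being adjacent along an
antidiagonal for any signs `σ`, `τ`. -/
theorem IsSpread.isMutualVisibilitySet (hs : 3 ≤ s) (ht : 3 ≤ t) (hP : IsSpread s t P) :
    IsMutualVisibilitySet (cycleGraph s □ cycleGraph t) (latticeSet s t P) := by
  have mem {x y : ℤ} := torusVertex_mem_latticeSet (x := x) (y := y) hP.of_modEq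
  intro u hu v hv
  obtain ⟨σ, hσ, p, hp, hvx⟩ := exists_short_displacement u.1 v.1
  obtain ⟨τ, hτ, q, hq, hvy⟩ := exists_short_displacement u.2 v.2
  have hu' : torusVertex s t u.1.val u.2.val = u := torusVertex_coe u
  have hv' : torusVertex s t (u.1.val + σ * p) (u.2.val + τ * q) = v :=
    (Prod.ext hvx hvy).symm
  generalize (u.1.val : ℤ) = x at hu' hv'
  generalize (u.2.val : ℤ) = y at hu' hv'
  subst hu' hv'
  rw [mem] at hu hv
  have row' : ∀ {a b d : ℤ}, 0 < d → P a b → P (a + σ * d) b → s < 4 * d := by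
    intro a b d hd h1 h2
    rcases hσ with rfl | rfl
    · exact hP.row hd h1 (by simpa using h2)
    · exact hP.row hd h2 (by simpa using h1)
  have col' : ∀ {a b d : ℤ}, 0 < d → P a b → P a (b + τ * d) → t < 4 * d := by
    intro a b d hd h1 h2
    rcases hτ with rfl | rfl
    · exact hP.col hd h1 (by simpa using h2)
    · exact hP.col hd h2 (by simpa using h1)
  have anti' : ∀ {a b : ℤ}, P (a + σ) b → ¬ P a (b + τ) := by
    intro a b h1 h2
    rcases hσ with rfl | rfl <;> rcases hτ with rfl | rfl
    · exact hP.antidiag h2 h1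
    · exact hP.diag h2 (by simpa using h1)
    · exact hP.diag h1 (by simpa using h2)
    · exact hP.antidiag (x := a + -1) (y := b + -1) (by simpa using h1) (by simpa using h2)
  obtain ⟨h, h0, hend, hstep, hfree⟩ := exists_staircase
    -- The two corners are `u` and `v` themselves, so they do not count as obstacles.
    (O := fun i j => i ≤ p ∧ j ≤ q ∧ (i ≠ 0 ∨ j ≠ 0) ∧ (i ≠ p ∨ j ≠ q) ∧
      P (x + σ * i) (y + τ * j)) (p := p) (q := q) (by simp) (by simp)
    (by
      rintro i j ⟨-, -, -, -, h1⟩ ⟨-, -, -, -, h2⟩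
      refine anti' (a := x + σ * i) (b := y + τ * j) ?_ ?_
      · convert h1 using 1; push_cast; ring
      · convert h2 using 1; push_cast; ring)
    (by
      rintro b c ⟨-, hb, hb0, -, h1⟩ ⟨-, hc, -, hc0, h2⟩
      by_contra hcb
      have h3 : (t : ℤ) < 4 * b :=
        col' (by omega) hu (by simpa using h1)
      have h4 : (t : ℤ) < 4 * (q - c) := by
        refine col' (a := x + σ * p) (b := y + τ * c) (by omega) h2 ?_
        convert hv using 1; ring
      omega)
    (by
      rintro b c ⟨hb, -, hb0, -, h1⟩ ⟨hc, -, -, hc0, h2⟩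
      by_contra hcb
      have h3 : (s : ℤ) < 4 * b :=
        row' (by omega) hu (by simpa using h1)
      have h4 : (s : ℤ) < 4 * (p - c) := by
        refine row' (a := x + σ * c) (b := y + τ * q) (by omega) h2 ?_
        convert hv using 1; ring
      omega)
  have hle : ∀ n ≤ p + q, h n ≤ n := by
    intro n
    induction n with
    | zero => simp [h0]
    | succ n ih =>
      intro hn
      have := ih (by omega)
      rcases hstep n (by omega) with e | e <;> omega
  -- the staircase stays inside the rectangle
  have hin : ∀ k, k ≤ p + q → h (p + q - k) ≤ q ∧ q ≤ h (p + q - k) + k := by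
    intro k
    induction k with
    | zero => simp [hend]
    | succ k ih =>
      intro hk
      have := ih (by omega)
      have h5 := hstep (p + q - (k + 1)) (by omega)
      rw [show p + q - (k + 1) + 1 = p + q - k by omega] at h5
      omega
  refine mVisible_of_staircase hs ht x y hσ hτ hp hq h h0 hend hstep ?_
  intro n hn0 hn1 hmem
  rw [mem] at hmem
  have h1 := hle n hn1.le
  have h2 := hin (p + q - n) (by omega)
  rw [show p + q - (p + q - n) = n by omega] at h2
  refine hfree n hn1.le ⟨by omega, by omega, by omega, by omega, ?_⟩
  rwa [Nat.cast_sub h1]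

/-- A doubly periodic set with three points in every row has at least `3 * t` points on the
torus. -/
theorem le_ncard_latticeSet
    (hP : ∀ {x x' y y' : ℤ}, x ≡ x' [ZMOD s] → y ≡ y' [ZMOD t] → P x y → P x' y')
    (h3 : ∀ y, ∃ a b c : ℤ, a < b ∧ b < c ∧ c < a + s ∧ P a y ∧ P b y ∧ P c y) :
    3 * t ≤ (latticeSet s t P).ncard := by
  choose a b c hab hbc hca ha hb hc using h3
  let g : ℤ → Fin 3 → ℤ := fun y => ![a y, b y, c y]
  have hg : ∀ y j, P (g y j) y := by
    intro y j
    fin_cases j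
    · exact ha y
    · exact hb y
    · exact hc y
  let F : Fin t × Fin 3 → Fin s × Fin t := fun z => (cycleVertex s (g z.1.val z.2), z.1)
  have hF : Function.Injective F := by
    rintro ⟨y, i⟩ ⟨y', j⟩ h
    simp only [F, Prod.mk.injEq] at h
    obtain ⟨h1, rfl⟩ := h
    rw [cycleVertex_eq_iff] at h1
    have key : ∀ z w : ℤ, z ≡ w [ZMOD s] → w < z + s → z < w + s → z = w := by
      intro z w hzw h1 h2
      obtain ⟨k, hk⟩ := hzw.dvd
      have hs : (0 : ℤ) < s := by exact_mod_cast Nat.pos_of_neZero s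
      have : k < 1 := by nlinarith
      have : -1 < k := by nlinarith
      have : k = 0 := by omega
      subst this
      linarith
    have h2 := hab y.val
    have h3 := hbc y.val
    have h4 := hca y.val
    have h5 : g y.val i = g y.val j := by
      apply key _ _ h1 <;> fin_cases i <;> fin_cases j <;> simp [g] <;> omega
    have : i = j := by
      fin_cases i <;> fin_cases j <;> simp [g] at h5 ⊢ <;> omega
    rw [this]
  have hsub : Set.range F ⊆ latticeSet s t P := by
    rintro _ ⟨⟨y, i⟩, rfl⟩
    have : F (y, i) = torusVertex s t (g y.val i) y.val :=
      Prod.ext rfl (cycleVertex_coe y).symm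
    rw [this, torusVertex_mem_latticeSet hP]
    exact hg _ _
  calc 3 * t = Nat.card (Fin t × Fin 3) := by simp [mul_comm]
    _ = (Set.range F).ncard := by rw [← Set.image_univ, Set.ncard_image_of_injective _ hF,
        Set.ncard_univ]
    _ ≤ _ := Set.ncard_le_ncard hsub (Set.toFinite _)

end

/-! ### The upper bound: at most three points per row -/

section upper

/-- Projection to the first factor deletes the steps taken in the second. Equal length means that
none was deleted, so the second coordinate never changed. -/
theorem exists_walk_left_le {V W : Type*} {G : SimpleGraph V} {H : SimpleGraph W}
    {u v : V × W} (w : (G □ H).Walk u v) :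
    ∃ p : G.Walk u.1 v.1, p.length ≤ w.length ∧
      (p.length = w.length → ∀ z ∈ w.support, z.2 = u.2) := by
  induction w with
  | nil => exact ⟨Walk.nil, le_rfl, by simp⟩
  | @cons u a v h w ih =>
    obtain ⟨p, hp, hp'⟩ := ih
    rw [boxProd_adj] at h
    rcases h with ⟨h, h2⟩ | ⟨h, h2⟩
    · refine ⟨Walk.cons h p, by simpa using hp, ?_⟩
      intro he z hz
      rw [Walk.support_cons, List.mem_cons] at hz
      rcases hz with rfl | hz
      · rfl
      · rw [h2]
        exact hp' (by simpa using he) z hz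
    · refine ⟨p.copy h2.symm rfl, by simp; omega, ?_⟩
      intro he
      simp at he
      omega

/-- Shortest paths between vertices of one layer of a box product stay in that layer. -/
theorem snd_eq_of_mem_support_of_length_eq_dist {V W : Type*} {G : SimpleGraph V}
    {H : SimpleGraph W} {a c : V} {y : W} (w : (G □ H).Walk (a, y) (c, y))
    (hw : w.length = (G □ H).dist (a, y) (c, y)) {z : V × W} (hz : z ∈ w.support) : z.2 = y := by
  obtain ⟨p, hp, hp'⟩ := exists_walk_left_le w
  refine hp' (le_antisymm hp ?_) z hz
  rw [hw]
  refine (dist_le (p.boxProdLeft H y)).trans (le_of_eq ?_)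
  exact Walk.length_map _ _

/-- A walk that avoids two layers `b` and `d` of a toroidal grid does not pass between them. -/
theorem not_between_of_walk {s : ℕ} (hs : 3 ≤ s) {W : Type*} {H : SimpleGraph W} {b d : Fin s}
    {u v : Fin s × W} (w : (cycleGraph s □ H).Walk u v)
    (hw : ∀ z ∈ w.support, z.1 ≠ b ∧ z.1 ≠ d) (hu : ¬ (b < u.1 ∧ u.1 < d)) :
    ¬ (b < v.1 ∧ v.1 < d) := by
  induction w with
  | nil => exact hu
  | @cons u a v h w ih =>
    refine ih (fun z hz => hw z (by simp [hz])) ?_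
    have h1 := hw u (by simp)
    have h2 := hw a (by simp)
    rw [boxProd_adj] at h
    rcases h with ⟨h, -⟩ | ⟨-, h⟩
    · rw [cycleGraph_adj_iff_val hs] at h
      have := a.1.isLt
      have := u.1.isLt
      have := b.isLt
      have := d.isLt
      simp only [Fin.lt_def, Fin.ne_iff_vne] at *
      omega
    · rwa [h] at hu

/-- With four points in a row, a geodesic from the first to the third stays in the row and avoids
the second and fourth. It would have to enter the interval between these two without touching its
ends. -/
theorem ncard_le_of_isMutualVisibilitySet {s t : ℕ} (hs : 3 ≤ s) {M : Set (Fin s × Fin t)}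
    (hM : IsMutualVisibilitySet (cycleGraph s □ cycleGraph t) M) : M.ncard ≤ 3 * t := by
  classical
  have hfin := M.toFinite
  rw [Set.ncard_eq_toFinset_card M hfin]
  have h := Finset.card_le_mul_card_image_of_maps_to (s := hfin.toFinset)
    (t := (Finset.univ : Finset (Fin t))) (f := Prod.snd) (fun _ _ => Finset.mem_univ _) 3 ?_
  · simpa using h
  intro y _
  by_contra hcon
  push Not at hcon
  set A := ({x ∈ hfin.toFinset | x.2 = y} : Finset _).image Prod.fst with hA
  have hcard : A.card = ({x ∈ hfin.toFinset | x.2 = y} : Finset (Fin s × Fin t)).card := by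
    apply Finset.card_image_of_injOn
    intro z hz z' hz' e
    simp at hz hz'
    exact Prod.ext e (hz.2.trans hz'.2.symm)
  have hmem : ∀ x ∈ A, (x, y) ∈ M := by
    intro x hx
    simp only [hA, Finset.mem_image, Finset.mem_filter, Set.Finite.mem_toFinset] at hx
    obtain ⟨z, ⟨hz, rfl⟩, rfl⟩ := hx
    exact hz
  let f := A.orderEmbOfFin rfl
  have hf : ∀ i, (f i, y) ∈ M := fun i => hmem _ (A.orderEmbOfFin_mem rfl i)
  have hlt : ∀ i j : ℕ, (hi : i < A.card) → (hj : j < A.card) → i < j →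
      f ⟨i, hi⟩ < f ⟨j, hj⟩ := by
    intro i j hi hj hij
    exact f.strictMono hij
  have h01 := hlt 0 1 (by omega) (by omega) (by omega)
  have h12 := hlt 1 2 (by omega) (by omega) (by omega)
  have h23 := hlt 2 3 (by omega) (by omega) (by omega)
  obtain ⟨w, -, hw, hvis⟩ := hM _ (hf ⟨0, by omega⟩) _ (hf ⟨2, by omega⟩)
  refine not_between_of_walk hs (b := f ⟨1, by omega⟩) (d := f ⟨3, by omega⟩) w ?_
    (fun h => lt_asymm h01 h.1) ⟨h12, h23⟩
  intro z hz
  have hzy := snd_eq_of_mem_support_of_length_eq_dist w hw hz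
  have hne : ∀ x, (x, y) ∈ M → x ≠ f ⟨0, by omega⟩ → x ≠ f ⟨2, by omega⟩ → z.1 ≠ x := by
    rintro x hx h1 h2 rfl
    have hzM : z ∈ M := by rwa [← hzy] at hx
    rcases hvis z hz hzM with e | e
    · exact h1 (by rw [e])
    · exact h2 (by rw [e])
  exact ⟨hne _ (hf _) h01.ne' h12.ne, hne _ (hf _) (h01.trans (h12.trans h23)).ne' h23.ne'⟩

theorem mutualVisibilityNumber_eq_of_exists {s t : ℕ} (hs : 3 ≤ s) {M : Set (Fin s × Fin t)}
    (hM : IsMutualVisibilitySet (cycleGraph s □ cycleGraph t) M) (hcard : 3 * t ≤ M.ncard) :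
    mutualVisibilityNumber (cycleGraph s □ cycleGraph t) = 3 * t := by
  refine le_antisymm (csSup_le ⟨_, M, hM, rfl⟩ ?_) (hcard.trans (le_csSup ⟨3 * t, ?_⟩ ⟨M, hM, rfl⟩))
  · rintro _ ⟨M', hM', rfl⟩
    exact ncard_le_of_isMutualVisibilitySet hs hM'
  · rintro _ ⟨M', hM', rfl⟩
    exact ncard_le_of_isMutualVisibilitySet hs hM'

end upper

/-! ### Stretching a base set to longer cycles -/

/-- A doubly periodic set of lattice points with three points in every row, in which points on a
common row have distance at least `r`, points on a common column are more than a quarter of the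
period apart, and no two points are diagonally adjacent. -/
structure IsSpreadBase (s t : ℕ) (r : ℤ) (P : ℤ → ℤ → Prop) : Prop where
  of_modEq : ∀ {x x' y y' : ℤ}, x ≡ x' [ZMOD s] → y ≡ y' [ZMOD t] → P x y → P x' y'
  row : ∀ {x y d : ℤ}, 0 < d → P x y → P (x + d) y → r ≤ d
  col : ∀ {x y d : ℤ}, 0 < d → P x y → P x (y + d) → t < 4 * d
  diag : ∀ {x y : ℤ}, P x y → ¬ P (x + 1) (y + 1)
  antidiag : ∀ {x y : ℤ}, P x (y + 1) → ¬ P (x + 1) y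
  exists_three : ∀ y, ∃ a b c : ℤ, a < b ∧ b < c ∧ c < a + s ∧ P a y ∧ P b y ∧ P c y

section stretch
variable {s₀ s : ℕ}

/-- Stretching a cycle of length `s₀` to length `s`. -/
def stretch (s₀ s : ℕ) (x : ℤ) : ℤ := x * s / s₀

theorem stretch_add_mul (h₀ : 0 < s₀) (x k : ℤ) :
    stretch s₀ s (x + k * s₀) = stretch s₀ s x + k * s := by
  unfold stretch
  rw [show (x + k * s₀) * (s : ℤ) = x * s + k * s * s₀ by ring,
    Int.add_mul_ediv_right _ _ (by omega)]

theorem sub_le_stretch_sub (h₀ : 0 < s₀) (hs : s₀ ≤ s) {x y : ℤ} (hxy : x ≤ y) :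
    y - x ≤ stretch s₀ s y - stretch s₀ s x := by
  have h₀' : (0 : ℤ) < s₀ := by exact_mod_cast h₀
  have hs' : (s₀ : ℤ) ≤ s := by exact_mod_cast hs
  have h : stretch s₀ s x + (y - x) ≤ stretch s₀ s y := by
    unfold stretch
    rw [← Int.add_mul_ediv_right _ _ h₀'.ne']
    apply Int.ediv_le_ediv h₀'
    nlinarith
  linarith

theorem stretch_lt_iff (h₀ : 0 < s₀) (hs : s₀ ≤ s) {x y : ℤ} :
    stretch s₀ s x < stretch s₀ s y ↔ x < y := by
  constructor
  · intro h
    by_contra hcon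
    have := sub_le_stretch_sub h₀ hs (not_lt.1 hcon)
    omega
  · intro h
    have := sub_le_stretch_sub h₀ hs h.le
    omega

/-- Rounding costs less than 1, so `d > r * s / s₀ - 1`. The slack 4 in `hr` contributes `s / s₀ ≥
1` to `r * s / s₀` beyond `s / 4`, which pays for the rounding. -/
theorem stretch_sub_lt (h₀ : 0 < s₀) {r d x y : ℤ} (hr : (s₀ : ℤ) + 4 ≤ 4 * r) (hs : s₀ ≤ s)
    (hxy : r ≤ y - x) (hd : stretch s₀ s y = stretch s₀ s x + d) : (s : ℤ) < 4 * d := by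
  have h₀' : (0 : ℤ) < s₀ := by exact_mod_cast h₀
  have hs' : (s₀ : ℤ) ≤ s := by exact_mod_cast hs
  have h1 : stretch s₀ s x * s₀ ≤ x * s := Int.ediv_mul_le _ h₀'.ne'
  have h2 : y * s < (stretch s₀ s y + 1) * s₀ := Int.lt_ediv_add_one_mul_self _ h₀'
  rw [hd] at h2
  have h3 : (y - x) * s < (d + 1) * s₀ := by linarith
  have h4 : r * s ≤ (y - x) * s := by nlinarith
  have h5 : ((s₀ : ℤ) + 4) * s ≤ 4 * r * s := by nlinarith
  by_contra hcon
  nlinarith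

/-- Stretching is injective and never decreases distances, so columns are unchanged and no diagonal
adjacency arises. For rows, either `r` already exceeds `s / 4`, or the slack in `r` works for every
`s ≥ s₀`. -/
theorem IsSpreadBase.isSpread {t : ℕ} {r : ℤ} {P : ℤ → ℤ → Prop} (hP : IsSpreadBase s₀ t r P)
    (h₀ : 0 < s₀) (hs : s₀ ≤ s) (hr : (s : ℤ) < 4 * r ∨ (s₀ : ℤ) + 4 ≤ 4 * r) :
    IsSpread s t fun x y => ∃ z, P z y ∧ stretch s₀ s z = x where
  of_modEq := by
    rintro x x' y y' hx hy ⟨z, hz, rfl⟩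
    obtain ⟨k, hk⟩ := hx.dvd
    refine ⟨z + k * s₀, hP.of_modEq ?_ hy hz, ?_⟩
    · rw [Int.modEq_iff_dvd]; exact ⟨k, by ring⟩
    · rw [stretch_add_mul h₀]; linarith
  row := by
    rintro x y d hd ⟨z, hz, rfl⟩ ⟨w, hw, hwd⟩
    have hlt : z < w := (stretch_lt_iff h₀ hs).1 (by omega)
    have hrd : r ≤ w - z := hP.row (by omega) hz (by simpa using hw)
    rcases hr with hr | hr
    · have := sub_le_stretch_sub h₀ hs hlt.le
      omega
    · exact stretch_sub_lt h₀ hr hs hrd hwd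
  col := by
    rintro x y d hd ⟨z, hz, rfl⟩ ⟨w, hw, hwd⟩
    have h1 : ¬ z < w := fun h => by have := (stretch_lt_iff h₀ hs).2 h; omega
    have h2 : ¬ w < z := fun h => by have := (stretch_lt_iff h₀ hs).2 h; omega
    have : w = z := by omega
    subst this
    exact hP.col hd hz hw
  diag := by
    rintro x y ⟨z, hz, rfl⟩ ⟨w, hw, hwd⟩
    have hlt : z < w := (stretch_lt_iff h₀ hs).1 (by omega)
    have := sub_le_stretch_sub h₀ hs hlt.le
    have : w = z + 1 := by omega
    subst this
    exact hP.diag hz hw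
  antidiag := by
    rintro x y ⟨z, hz, rfl⟩ ⟨w, hw, hwd⟩
    have hlt : z < w := (stretch_lt_iff h₀ hs).1 (by omega)
    have := sub_le_stretch_sub h₀ hs hlt.le
    have : w = z + 1 := by omega
    subst this
    exact hP.antidiag hz hw

theorem IsSpreadBase.mutualVisibilityNumber_eq {t : ℕ} {r : ℤ} {P : ℤ → ℤ → Prop}
    (hP : IsSpreadBase s₀ t r P) (h₀ : 3 ≤ s₀) (ht : 3 ≤ t) (hs : s₀ ≤ s)
    (hr : (s : ℤ) < 4 * r ∨ (s₀ : ℤ) + 4 ≤ 4 * r) :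
    mutualVisibilityNumber (cycleGraph s □ cycleGraph t) = 3 * t := by
  have : NeZero s := ⟨by omega⟩
  have : NeZero t := ⟨by omega⟩
  have h := hP.isSpread (by omega) hs hr
  refine mutualVisibilityNumber_eq_of_exists (by omega)
    (h.isMutualVisibilitySet (by omega) ht) (le_ncard_latticeSet h.of_modEq ?_)
  intro y
  obtain ⟨a, b, c, hab, hbc, hca, ha, hb, hc⟩ := hP.exists_three y
  refine ⟨_, _, _, (stretch_lt_iff (by omega) hs).2 hab, (stretch_lt_iff (by omega) hs).2 hbc, ?_,
    ⟨a, ha, rfl⟩, ⟨b, hb, rfl⟩, ⟨c, hc, rfl⟩⟩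
  have := stretch_add_mul (s := s) (show 0 < s₀ by omega) a 1
  rw [one_mul, one_mul] at this
  rw [← this]
  exact (stretch_lt_iff (by omega) hs).2 hca

end stretch

/-! ### Residues far from zero -/

section strands

/-- Among integers, three residue classes have representatives in increasing order within one
period. -/
theorem exists_sorted_representatives {s : ℕ} (hs : 0 < s) {g : Fin 3 → ℤ}
    (hg : ∀ i j, i ≠ j → ¬ g i ≡ g j [ZMOD s]) :
    ∃ a b c : ℤ, a < b ∧ b < c ∧ c < a + s ∧ (∃ i, a ≡ g i [ZMOD s]) ∧
      (∃ i, b ≡ g i [ZMOD s]) ∧ ∃ i, c ≡ g i [ZMOD s] := by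
  have hs' : (0 : ℤ) < s := by exact_mod_cast hs
  have h0 : ∀ i, 0 ≤ g i % s := fun i => Int.emod_nonneg _ hs'.ne'
  have h1 : ∀ i, g i % s < s := fun i => Int.emod_lt_of_pos _ hs'
  have key : ∀ i j k : Fin 3, g i % s < g j % s → g j % s < g k % s →
      ∃ a b c : ℤ, a < b ∧ b < c ∧ c < a + s ∧ (∃ i, a ≡ g i [ZMOD s]) ∧
      (∃ i, b ≡ g i [ZMOD s]) ∧ ∃ i, c ≡ g i [ZMOD s] := by
    intro i j k hij hjk
    refine ⟨_, _, _, hij, hjk, ?_, ⟨i, Int.mod_modEq _ _⟩, ⟨j, Int.mod_modEq _ _⟩,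
      ⟨k, Int.mod_modEq _ _⟩⟩
    have := h0 i
    have := h1 k
    omega
  have h01 : g 0 % s ≠ g 1 % s := hg 0 1 (by decide)
  have h12 : g 1 % s ≠ g 2 % s := hg 1 2 (by decide)
  have h02 : g 0 % s ≠ g 2 % s := hg 0 2 (by decide)
  rcases lt_or_gt_of_ne h01 with a | a <;> rcases lt_or_gt_of_ne h12 with b | b <;>
    rcases lt_or_gt_of_ne h02 with c | c
  · exact key 0 1 2 a b
  · exact key 0 1 2 a b
  · exact key 0 2 1 c b
  · exact key 2 0 1 c a
  · exact key 1 0 2 a c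
  · exact key 1 2 0 b c
  · exact key 2 1 0 b a
  · exact key 2 1 0 b a

/-- The residue of `z` modulo `n` has distance at least `r` from `0` on the cycle. -/
def IsFar (n : ℕ) (r z : ℤ) : Prop := r ≤ z % n ∧ z % n ≤ n - r

/-- The certificate form used for the families below: `e` is the reduced representative and `k` the
quotient, leaving one ring identity and linear inequalities. -/
theorem isFar_of_eq {n : ℕ} {r z e k : ℤ} (hr : 0 < r) (hz : z = e + n * k) (h1 : r ≤ e)
    (h2 : e ≤ n - r) : IsFar n r z := by
  rw [IsFar, hz, Int.add_mul_emod_self_left, Int.emod_eq_of_lt (by omega) (by omega)]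
  exact ⟨h1, h2⟩

theorem IsFar.neg {n : ℕ} {r z : ℤ} (hr : 0 < r) (h : IsFar n r z) : IsFar n r (-z) := by
  refine isFar_of_eq (e := n - z % n) (k := -(z / n) - 1) hr ?_ ?_ ?_
  · have := Int.emod_add_mul_ediv z n
    linarith
  · linarith [h.2]
  · linarith [h.1]

theorem IsFar.le {n : ℕ} {r z d : ℤ} (h : IsFar n r z) (hd : 0 < d) (hdz : d ≡ z [ZMOD n]) :
    r ≤ d := by
  have h1 : d % n = z % n := hdz
  have h2 := h.1
  rw [← h1] at h2
  have h3 := Int.emod_add_mul_ediv d n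
  have h4 : 0 ≤ (n : ℤ) * (d / n) := mul_nonneg (by positivity) (Int.ediv_nonneg hd.le (by positivity))
  linarith

theorem IsFar.not_modEq {n : ℕ} {r z d : ℤ} (h : IsFar n r z) (hd : -r < d) (hd' : d < r) :
    ¬ z ≡ d [ZMOD n] := by
  intro hzd
  have h1 : z % n = d % n := hzd
  have h2 := h.1
  have h3 := h.2
  rw [h1] at h2 h3
  rcases lt_or_ge d 0 with hd0 | hd0
  · have h4 : d % n = (d + n) % n := by simp
    rw [h4, Int.emod_eq_of_lt (by omega) (by omega)] at h3
    omega
  · rw [Int.emod_eq_of_lt hd0 (by omega)] at h2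
    omega

end strands

/-! ### Three cosets of a line in the `t` by `t` torus -/

section affine

/-- Three cosets of the line of slope `c` in the torus. -/
def affineSet (t : ℕ) (c a b x y : ℤ) : Prop :=
  x ≡ c * y [ZMOD t] ∨ x ≡ c * (y + a) [ZMOD t] ∨ x ≡ c * (y + b) [ZMOD t]

theorem affineSet_iff {t : ℕ} {c a b x y : ℤ} :
    affineSet t c a b x y ↔ ∃ i : Fin 3, x ≡ c * (y + ![0, a, b] i) [ZMOD t] := by
  simp [affineSet, Fin.exists_fin_succ]

/-- For strands with offsets `ν i` and `ν j`, row differences are `c * (ν j - ν i)` and, `c` being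
invertible, column differences are `ν i - ν j`. A diagonal adjacency would force some `c * (1 + (ν i
- ν j))` to be `1` or `-1`. So finitely many residues decide everything. -/
theorem affineSet_isSpreadBase {t : ℕ} {r r' c a b : ℤ} (hr : 0 < r) (hr' : (t : ℤ) < 4 * r')
    (ht : 0 < t) (hrt : r ≤ t) (hc : IsCoprime c t)
    (ra : IsFar t r (c * a)) (rb : IsFar t r (c * b)) (rab : IsFar t r (c * (b - a)))
    (ca : IsFar t r' a) (cb : IsFar t r' b) (cab : IsFar t r' (b - a))
    (d₀ : IsFar t 2 c) (da : IsFar t 2 (c * (1 + a))) (da' : IsFar t 2 (c * (1 - a)))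
    (db : IsFar t 2 (c * (1 + b))) (db' : IsFar t 2 (c * (1 - b)))
    (dab : IsFar t 2 (c * (1 + (b - a)))) (dab' : IsFar t 2 (c * (1 - (b - a)))) :
    IsSpreadBase t t r (affineSet t c a b) := by
  have ht' : (0 : ℤ) < t := by exact_mod_cast ht
  set ν : Fin 3 → ℤ := ![0, a, b] with hν
  have hrow : ∀ i j, i ≠ j → IsFar t r (c * (ν i - ν j)) := by
    have h1 := ra.neg hr
    have h2 := rb.neg hr
    have h3 := rab.neg hr
    intro i j hij
    fin_cases i <;> fin_cases j <;> simp [hν] at hij ⊢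
    · exact h1
    · exact h2
    · exact ra
    · convert h3 using 1; ring
    · exact rb
    · exact rab
  have hcol : ∀ i j, i ≠ j → IsFar t r' (ν i - ν j) := by
    have h1 := ca.neg (by omega)
    have h2 := cb.neg (by omega)
    have h3 := cab.neg (by omega)
    intro i j hij
    fin_cases i <;> fin_cases j <;> simp [hν] at hij ⊢
    · exact h1
    · exact h2
    · exact ca
    · convert h3 using 1; ring
    · exact cb
    · exact cab
  have hdiag : ∀ i j, IsFar t 2 (c * (1 + (ν i - ν j))) := by
    intro i j
    fin_cases i <;> fin_cases j <;> simp [hν]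
    · exact d₀
    · exact da'
    · exact db'
    · exact da
    · exact d₀
    · convert dab' using 2; ring
    · exact db
    · exact dab
    · exact d₀
  have hpos : ∀ d : ℤ, 0 < d → d ≡ 0 [ZMOD t] → (t : ℤ) ≤ d := fun d hd h =>
    Int.le_of_dvd hd (Int.modEq_zero_iff_dvd.1 h)
  refine ⟨?_, ?_, ?_, ?_, ?_, ?_⟩
  · intro x x' y y' hx hy h
    rw [affineSet_iff] at h ⊢
    obtain ⟨i, hi⟩ := h
    exact ⟨i, hx.symm.trans (hi.trans ((hy.add_right _).mul_left _))⟩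
  · intro x y d hd h1 h2
    rw [affineSet_iff] at h1 h2
    obtain ⟨i, hi⟩ := h1
    obtain ⟨j, hj⟩ := h2
    have h3 : d ≡ c * (ν j - ν i) [ZMOD t] := by
      have := hj.sub hi
      ring_nf at this ⊢
      exact this
    by_cases hij : j = i
    · subst hij
      exact hrt.trans (hpos d hd (by simpa using h3))
    · exact (hrow j i hij).le hd h3
  · intro x y d hd h1 h2
    rw [affineSet_iff] at h1 h2
    obtain ⟨i, hi⟩ := h1
    obtain ⟨j, hj⟩ := h2
    have h3 : d ≡ ν i - ν j [ZMOD t] := by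
      have h4 : c * (y + ν i) ≡ c * (y + d + ν j) [ZMOD t] := hi.symm.trans hj
      have h5 := h4.dvd
      rw [← mul_sub] at h5
      have h6 := hc.symm.dvd_of_dvd_mul_left h5
      rw [Int.modEq_iff_dvd]
      have := (Int.dvd_neg.2 h6)
      convert this using 1
      ring
    by_cases hij : i = j
    · subst hij
      have := hpos d hd (by simpa using h3)
      omega
    · have := (hcol i j hij).le hd h3
      omega
  · intro x y h1 h2
    rw [affineSet_iff] at h1 h2
    obtain ⟨i, hi⟩ := h1
    obtain ⟨j, hj⟩ := h2
    refine (hdiag j i).not_modEq (d := 1) (by norm_num) (by norm_num) ?_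
    have := (hj.sub hi).symm
    ring_nf at this ⊢
    exact this
  · intro x y h1 h2
    rw [affineSet_iff] at h1 h2
    obtain ⟨i, hi⟩ := h1
    obtain ⟨j, hj⟩ := h2
    refine (hdiag i j).not_modEq (d := -1) (by norm_num) (by norm_num) ?_
    have := (hi.sub hj).symm
    ring_nf at this ⊢
    exact this
  · intro y
    obtain ⟨u, v, w, huv, hvw, hwu, ⟨i, hi⟩, ⟨j, hj⟩, ⟨k, hk⟩⟩ :=
      exists_sorted_representatives ht (g := fun i => c * (y + ν i)) (by
        intro i j hij h
        refine (hrow i j hij).not_modEq (d := 0) (by omega) hr ?_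
        have := h.sub_right (c * (y + ν j))
        ring_nf at this ⊢
        exact this)
    exact ⟨u, v, w, huv, hvw, hwu, affineSet_iff.2 ⟨i, hi⟩, affineSet_iff.2 ⟨j, hj⟩,
      affineSet_iff.2 ⟨k, hk⟩⟩

/-- With `c = 2`, offsets near `t/3` and `2t/3` are swapped up to rounding, so rows and columns are
both nearly equally spaced. For `t = 17, 19, 25` the residue `4k + 2ρ - t` of `2b` is `5, 5, 7`,
below the required `6, 6, 8`. -/
theorem mutualVisibilityNumber_of_odd {s t : ℕ} (hst : t ≤ s) (hodd : t % 2 = 1) (ht : 15 ≤ t)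
    (h17 : t ≠ 17) (h19 : t ≠ 19) (h25 : t ≠ 25) :
    mutualVisibilityNumber (cycleGraph s □ cycleGraph t) = 3 * t := by
  obtain ⟨k, hk⟩ : ∃ k, k = t / 3 := ⟨_, rfl⟩
  -- The correction that makes `2 * k + ρ` equal to `⌊2t/3⌋`.
  obtain ⟨ρ, hρ⟩ : ∃ ρ, ρ = t % 3 / 2 := ⟨_, rfl⟩
  have h3 : t % 3 = 0 ∨ t % 3 = 1 ∨ t % 3 = 2 := by omega
  -- These are the least `r` with `t + 4 ≤ 4 * r`, as stretching needs, and the least `r'` with `t <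
  -- 4 * r'`.
  refine (affineSet_isSpreadBase (t := t) (r := (t + 7) / 4) (r' := t / 4 + 1) (c := 2) (a := k)
    (b := 2 * k + ρ) (by omega) (by omega) (by omega) (by omega) ?_ ?_ ?_ ?_ ?_ ?_ ?_ ?_ ?_ ?_ ?_
    ?_ ?_ ?_).mutualVisibilityNumber_eq (by omega) (by omega) hst (Or.inr (by omega))
  · rw [Int.isCoprime_iff_gcd_eq_one]
    have : Nat.Coprime 2 t := (Nat.coprime_two_left).2 (Nat.odd_iff.2 hodd)
    exact_mod_cast this
  · exact isFar_of_eq (e := 2 * k) (k := 0) (by omega) (by ring) (by omega) (by omega)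
  · exact isFar_of_eq (e := 4 * k + 2 * ρ - t) (k := 1) (by omega) (by ring)
      (by rcases h3 with h | h | h <;> omega) (by omega)
  · exact isFar_of_eq (e := 2 * k + 2 * ρ) (k := 0) (by omega) (by ring) (by omega) (by omega)
  · exact isFar_of_eq (e := k) (k := 0) (by omega) (by ring) (by omega) (by omega)
  · exact isFar_of_eq (e := 2 * k + ρ) (k := 0) (by omega) (by ring) (by omega) (by omega)
  · exact isFar_of_eq (e := k + ρ) (k := 0) (by omega) (by ring) (by omega) (by omega)
  · exact isFar_of_eq (e := 2) (k := 0) (by omega) (by ring) (by omega) (by omega)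
  · exact isFar_of_eq (e := 2 + 2 * k) (k := 0) (by omega) (by ring) (by omega) (by omega)
  · exact isFar_of_eq (e := 2 - 2 * k + t) (k := -1) (by omega) (by ring) (by omega) (by omega)
  · exact isFar_of_eq (e := 2 + 4 * k + 2 * ρ - t) (k := 1) (by omega) (by ring) (by omega)
      (by omega)
  · exact isFar_of_eq (e := 2 - 4 * k - 2 * ρ + 2 * t) (k := -2) (by omega) (by ring) (by omega)
      (by omega)
  · exact isFar_of_eq (e := 2 + 2 * k + 2 * ρ) (k := 0) (by omega) (by ring) (by omega) (by omega)
  · exact isFar_of_eq (e := 2 - 2 * k - 2 * ρ + t) (k := -1) (by omega) (by ring) (by omega)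
      (by omega)

/-- The multiplier `c = t/2 + 1` fixes every even residue. Even offsets near `t/3` and `2t/3`
therefore give the same spacing in rows and columns, while odd multiples are shifted by `t/2`, away
from the diagonals. -/
theorem mutualVisibilityNumber_of_mod_four_eq_zero {s t : ℕ} (hst : t ≤ s) (h4 : t % 4 = 0)
    (ht : 24 ≤ t) : mutualVisibilityNumber (cycleGraph s □ cycleGraph t) = 3 * t := by
  obtain ⟨j, rfl⟩ : ∃ j, t = 4 * j := ⟨t / 4, by omega⟩
  obtain ⟨α, hα⟩ : ∃ α, α = 2 * j / 3 := ⟨_, rfl⟩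
  obtain ⟨β, hβ⟩ : ∃ β, β = 4 * j / 3 := ⟨_, rfl⟩
  refine (affineSet_isSpreadBase (t := 4 * j) (r := j + 1) (r' := j + 1) (c := 2 * j + 1)
    (a := 2 * α) (b := 2 * β) (by omega) (by omega) (by omega) (by omega) ?_ ?_ ?_ ?_ ?_ ?_ ?_ ?_
    ?_ ?_ ?_ ?_ ?_ ?_).mutualVisibilityNumber_eq (by omega) (by omega) hst (Or.inr (by omega))
  · exact ⟨2 * j + 1, -(j + 1), by push_cast; ring⟩
  · exact isFar_of_eq (e := 2 * α) (k := α) (by omega) (by push_cast; ring) (by omega) (by omega)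
  · exact isFar_of_eq (e := 2 * β) (k := β) (by omega) (by push_cast; ring) (by omega) (by omega)
  · exact isFar_of_eq (e := 2 * β - 2 * α) (k := β - α) (by omega) (by push_cast; ring) (by omega)
      (by omega)
  · exact isFar_of_eq (e := 2 * α) (k := 0) (by omega) (by ring) (by omega) (by omega)
  · exact isFar_of_eq (e := 2 * β) (k := 0) (by omega) (by ring) (by omega) (by omega)
  · exact isFar_of_eq (e := 2 * β - 2 * α) (k := 0) (by omega) (by ring) (by omega) (by omega)
  · exact isFar_of_eq (e := 2 * j + 1) (k := 0) (by omega) (by ring) (by omega) (by omega)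
  · exact isFar_of_eq (e := 2 * j + 1 + 2 * α) (k := α) (by omega) (by push_cast; ring) (by omega)
      (by omega)
  · exact isFar_of_eq (e := 2 * j + 1 - 2 * α) (k := -α) (by omega) (by push_cast; ring) (by omega)
      (by omega)
  · exact isFar_of_eq (e := 2 * β + 1 - 2 * j) (k := β + 1) (by omega) (by push_cast; ring)
      (by omega) (by omega)
  · exact isFar_of_eq (e := 6 * j + 1 - 2 * β) (k := -β - 1) (by omega) (by push_cast; ring)
      (by omega) (by omega)
  · exact isFar_of_eq (e := 2 * j + 1 + 2 * (β - α)) (k := β - α) (by omega) (by push_cast; ring)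
      (by omega) (by omega)
  · exact isFar_of_eq (e := 2 * j + 1 - 2 * (β - α)) (k := α - β) (by omega) (by push_cast; ring)
      (by omega) (by omega)

/-- Here `t/2 + 1` is even, hence not invertible. Instead `c = t/2 - 2` multiplies even residues by
`-2`, which sends offsets near `t/3` to residues near `t/3` again. -/
theorem mutualVisibilityNumber_of_mod_four_eq_two {s t : ℕ} (hst : t ≤ s) (h4 : t % 4 = 2)
    (ht : 30 ≤ t) (h34 : t ≠ 34) (h38 : t ≠ 38) :
    mutualVisibilityNumber (cycleGraph s □ cycleGraph t) = 3 * t := by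
  obtain ⟨j, rfl⟩ : ∃ j, t = 4 * j + 2 := ⟨t / 4, by omega⟩
  obtain ⟨α, hα⟩ : ∃ α, α = (2 * j + 1) / 3 := ⟨_, rfl⟩
  obtain ⟨β, hβ⟩ : ∃ β, β = 2 * (2 * j + 1) / 3 := ⟨_, rfl⟩
  refine (affineSet_isSpreadBase (t := 4 * j + 2) (r := j + 2) (r' := j + 1) (c := 2 * j - 1)
    (a := 2 * α) (b := 2 * β) (by omega) (by omega) (by omega) (by omega) ?_ ?_ ?_ ?_ ?_ ?_ ?_ ?_
    ?_ ?_ ?_ ?_ ?_ ?_).mutualVisibilityNumber_eq (by omega) (by omega) hst (Or.inr (by omega))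
  · exact ⟨2 * j - 1 + 2 * j * (j - 1), -(j * (j - 1)), by push_cast; ring⟩
  · exact isFar_of_eq (e := 4 * j + 2 - 4 * α) (k := α - 1) (by omega) (by push_cast; ring)
      (by omega) (by omega)
  · exact isFar_of_eq (e := 8 * j + 4 - 4 * β) (k := β - 2) (by omega) (by push_cast; ring)
      (by omega) (by omega)
  · exact isFar_of_eq (e := 4 * j + 2 - 4 * (β - α)) (k := β - α - 1) (by omega)
      (by push_cast; ring) (by omega) (by omega)
  · exact isFar_of_eq (e := 2 * α) (k := 0) (by omega) (by ring) (by omega) (by omega)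
  · exact isFar_of_eq (e := 2 * β) (k := 0) (by omega) (by ring) (by omega) (by omega)
  · exact isFar_of_eq (e := 2 * β - 2 * α) (k := 0) (by omega) (by ring) (by omega) (by omega)
  · exact isFar_of_eq (e := 2 * j - 1) (k := 0) (by omega) (by ring) (by omega) (by omega)
  · exact isFar_of_eq (e := 6 * j + 1 - 4 * α) (k := α - 1) (by omega) (by push_cast; ring)
      (by omega) (by omega)
  · exact isFar_of_eq (e := 4 * α - 2 * j - 3) (k := 1 - α) (by omega) (by push_cast; ring)
      (by omega) (by omega)
  · exact isFar_of_eq (e := 6 * j + 1 - 4 * β) (k := β - 1) (by omega) (by push_cast; ring)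
      (by omega) (by omega)
  · exact isFar_of_eq (e := 4 * β - 2 * j - 3) (k := 1 - β) (by omega) (by push_cast; ring)
      (by omega) (by omega)
  · exact isFar_of_eq (e := 6 * j + 1 - 4 * (β - α)) (k := β - α - 1) (by omega)
      (by push_cast; ring) (by omega) (by omega)
  · exact isFar_of_eq (e := 4 * (β - α) - 2 * j - 3) (k := 1 - (β - α)) (by omega)
      (by push_cast; ring) (by omega) (by omega)

theorem mutualVisibilityNumber_of_affineSet {s t : ℕ} (hst : t ≤ s) {c a b : ℤ}
    (h : 3 ≤ t ∧ Int.gcd c t = 1 ∧ IsFar t ((t + 7) / 4) (c * a) ∧ IsFar t ((t + 7) / 4) (c * b) ∧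
      IsFar t ((t + 7) / 4) (c * (b - a)) ∧ IsFar t (t / 4 + 1) a ∧ IsFar t (t / 4 + 1) b ∧
      IsFar t (t / 4 + 1) (b - a) ∧ IsFar t 2 c ∧ IsFar t 2 (c * (1 + a)) ∧
      IsFar t 2 (c * (1 - a)) ∧ IsFar t 2 (c * (1 + b)) ∧ IsFar t 2 (c * (1 - b)) ∧
      IsFar t 2 (c * (1 + (b - a))) ∧ IsFar t 2 (c * (1 - (b - a)))) :
    mutualVisibilityNumber (cycleGraph s □ cycleGraph t) = 3 * t := by
  obtain ⟨ht, hc, h1, h2, h3, h4, h5, h6, h7, h8, h9, h10, h11, h12, h13⟩ := h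
  exact (affineSet_isSpreadBase (by omega) (by omega) (by omega) (by omega)
    (Int.isCoprime_iff_gcd_eq_one.2 hc) h1 h2 h3 h4 h5 h6 h7 h8 h9 h10 h11 h12
    h13).mutualVisibilityNumber_eq ht ht hst (Or.inr (by omega))

instance (n : ℕ) (r z : ℤ) : Decidable (IsFar n r z) := inferInstanceAs (Decidable (_ ∧ _))

/-- For these `t` rounding spoils the uniform choices above, but other parameters satisfy the same
finite list of conditions. -/
theorem mutualVisibilityNumber_of_mem_sporadic {s t : ℕ} (hst : t ≤ s)
    (ht : t = 19 ∨ t = 25 ∨ t = 26 ∨ t = 34 ∨ t = 38) :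
    mutualVisibilityNumber (cycleGraph s □ cycleGraph t) = 3 * t := by
  rcases ht with rfl | rfl | rfl | rfl | rfl
  · exact mutualVisibilityNumber_of_affineSet hst (c := 9) (a := 5) (b := 12) (by decide)
  · exact mutualVisibilityNumber_of_affineSet hst (c := 6) (a := 7) (b := 14) (by decide)
  · exact mutualVisibilityNumber_of_affineSet hst (c := 5) (a := 7) (b := 14) (by decide)
  · exact mutualVisibilityNumber_of_affineSet hst (c := 5) (a := 9) (b := 18) (by decide)
  · exact mutualVisibilityNumber_of_affineSet hst (c := 5) (a := 10) (b := 20) (by decide)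

end affine

/-! ### Base sets given by tables -/

section table

/-- The doubly periodic set whose points in each row are listed by their residues. -/
def tableSet (s t : ℕ) (rows : List (List ℕ)) (x y : ℤ) : Prop :=
  (x % s).toNat ∈ rows.getD (y % t).toNat []

variable {s t : ℕ} {rows : List (List ℕ)}

theorem tableSet_of_modEq {x x' y y' : ℤ} (hx : x ≡ x' [ZMOD s]) (hy : y ≡ y' [ZMOD t])
    (h : tableSet s t rows x y) : tableSet s t rows x' y' := by
  unfold tableSet at *
  rwa [← (show x % s = x' % s from hx), ← (show y % t = y' % t from hy)]

theorem tableSet_natCast {a y : ℕ} (ha : a < s) (hy : y < t) :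
    tableSet s t rows a y ↔ a ∈ rows.getD y [] := by
  unfold tableSet
  rw [Int.emod_eq_of_lt (by positivity) (by exact_mod_cast hy),
    Int.emod_eq_of_lt (by positivity) (by exact_mod_cast ha), Int.toNat_natCast, Int.toNat_natCast]

/-- Every row of the table lists three residues. -/
def IsTripleTable (s t : ℕ) (rows : List (List ℕ)) : Prop :=
  ∀ y < t, (rows.getD y []).length = 3 ∧ (rows.getD y []).Nodup ∧ ∀ a ∈ rows.getD y [], a < s

instance : Decidable (IsTripleTable s t rows) := by unfold IsTripleTable; infer_instance

theorem toNat_emod_lt (ht : 0 < t) (y : ℤ) : (y % t).toNat < t := by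
  have := Int.emod_lt_of_pos y (show (0 : ℤ) < t by exact_mod_cast ht)
  omega

theorem toNat_emod_add (ht : 0 < t) (y : ℤ) (d : ℕ) :
    ((y + d) % t).toNat = ((y % t).toNat + d) % t := by
  have h0 := Int.emod_nonneg y (show (t : ℤ) ≠ 0 by omega)
  rw [← Int.emod_add_emod]
  nth_rewrite 1 [← Int.toNat_of_nonneg h0]
  exact_mod_cast Int.toNat_natCast _

theorem IsTripleTable.exists_three (hs : 0 < s) (ht : 0 < t) (h : IsTripleTable s t rows) (y : ℤ) :
    ∃ a b c : ℤ, a < b ∧ b < c ∧ c < a + s ∧ tableSet s t rows a y ∧ tableSet s t rows b y ∧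
      tableSet s t rows c y := by
  obtain ⟨h1, h2, h3⟩ := h _ (toNat_emod_lt ht y)
  obtain ⟨l, hl⟩ : ∃ l, l = rows.getD (y % t).toNat [] := ⟨_, rfl⟩
  rw [← hl] at h1 h2 h3
  let g : Fin 3 → ℤ := fun i => (l[i.val]'(by omega) : ℕ)
  have hlt : ∀ i : Fin 3, l[i.val]'(by omega) < s := fun i => h3 _ (List.getElem_mem _)
  obtain ⟨a, b, c, hab, hbc, hca, ⟨i, hi⟩, ⟨j, hj⟩, ⟨k, hk⟩⟩ :=
    exists_sorted_representatives hs (g := g) (by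
      intro i j hij h
      apply hij
      have h4 := hlt i
      have h5 := hlt j
      have h6 : l[i.val]'(by omega) = l[j.val]'(by omega) := by
        have := Nat.mod_eq_of_lt h4
        have := Nat.mod_eq_of_lt h5
        have h7 : ((l[i.val]'(by omega) : ℕ) : ℤ) % s = ((l[j.val]'(by omega) : ℕ) : ℤ) % s := h
        have h8 : (l[i.val]'(by omega)) % s = (l[j.val]'(by omega)) % s := by exact_mod_cast h7
        omega
      exact Fin.ext ((List.Nodup.getElem_inj_iff h2).1 h6))
  have key : ∀ (z : ℤ) (i : Fin 3), z ≡ g i [ZMOD s] → tableSet s t rows z y := by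
    intro z i hz
    refine tableSet_of_modEq hz.symm rfl ?_
    have h4 : (g i % s).toNat = l[i.val]'(by omega) := by
      rw [Int.emod_eq_of_lt (by positivity) (Int.ofNat_lt.2 (hlt i)), Int.toNat_natCast]
    rw [tableSet, h4, ← hl]
    exact List.getElem_mem _
  exact ⟨a, b, c, hab, hbc, hca, key _ _ hi, key _ _ hj, key _ _ hk⟩

/-- A finite form of the conditions of `IsSpreadBase` for a table. -/
def IsSpreadTable (s t r : ℕ) (rows : List (List ℕ)) : Prop :=
  IsTripleTable s t rows ∧
  (∀ y < t, ∀ a ∈ rows.getD y [], ∀ b ∈ rows.getD y [], a < b → r ≤ b - a ∧ r ≤ a + s - b) ∧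
  -- The shift `k + 1` runs through exactly the positive `d` with `4 * d ≤ t`.
  (∀ y < t, ∀ k < t / 4, ∀ a ∈ rows.getD y [], a ∉ rows.getD ((y + (k + 1)) % t) []) ∧
  (∀ y < t, ∀ a ∈ rows.getD y [], (a + 1) % s ∉ rows.getD ((y + 1) % t) []) ∧
  ∀ y < t, ∀ a ∈ rows.getD ((y + 1) % t) [], (a + 1) % s ∉ rows.getD y []

instance {r : ℕ} : Decidable (IsSpreadTable s t r rows) := by unfold IsSpreadTable; infer_instance

theorem le_of_modEq_of_lt {d e : ℤ} (hd : 0 < d) (he : e < s) (h : d ≡ e [ZMOD s]) : e ≤ d := by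
  obtain ⟨k, hk⟩ := h.dvd
  have : k < 1 := by
    by_contra hcon
    nlinarith [(by positivity : (0 : ℤ) ≤ s)]
  nlinarith [(by positivity : (0 : ℤ) ≤ s)]

theorem IsSpreadTable.isSpreadBase {r : ℕ} (hs : 0 < s) (ht : 0 < t) (hr : r ≤ s)
    (h : IsSpreadTable s t r rows) : IsSpreadBase s t r (tableSet s t rows) := by
  obtain ⟨h3, hrow, hcol, hdiag, hanti⟩ := h
  have hs0 : ∀ x : ℤ, ((x % s).toNat : ℤ) = x % s := fun x =>
    Int.toNat_of_nonneg (Int.emod_nonneg x (by omega))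
  refine ⟨tableSet_of_modEq, ?_, ?_, ?_, ?_, h3.exists_three hs ht⟩
  · intro x y d hd h1 h2
    unfold tableSet at h1 h2
    have hy := toNat_emod_lt ht y
    have hx := toNat_emod_lt hs x
    have hx' := toNat_emod_lt hs (x + d)
    have hmod : d ≡ (x + d) % s - x % s [ZMOD s] := by
      have := (Int.mod_modEq (x + d) s).sub (Int.mod_modEq x s)
      simpa using this.symm
    rw [← hs0 x, ← hs0 (x + d)] at hmod
    rcases lt_trichotomy (x % s).toNat ((x + d) % s).toNat with hlt | heq | hlt
    · have := hrow _ hy _ h1 _ h2 hlt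
      have := le_of_modEq_of_lt hd (by omega) hmod
      omega
    · rw [heq, sub_self] at hmod
      have := Int.le_of_dvd hd (Int.modEq_zero_iff_dvd.1 hmod)
      omega
    · have := hrow _ hy _ h2 _ h1 hlt
      have hmod' : d ≡ ((x + d) % s).toNat - (x % s).toNat + s [ZMOD s] := by
        simpa using hmod
      have := le_of_modEq_of_lt hd (by omega) hmod'
      omega
  · intro x y d hd h1 h2
    by_contra hcon
    obtain ⟨k, rfl⟩ : ∃ k : ℕ, d = ((k + 1 : ℕ) : ℤ) := ⟨(d - 1).toNat, by omega⟩
    unfold tableSet at h1 h2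
    rw [toNat_emod_add ht] at h2
    exact hcol _ (toNat_emod_lt ht y) k (by omega) _ h1 h2
  · intro x y h1 h2
    unfold tableSet at h1 h2
    have e1 := toNat_emod_add ht y 1
    have e2 := toNat_emod_add hs x 1
    rw [Nat.cast_one] at e1 e2
    rw [e1, e2] at h2
    exact hdiag _ (toNat_emod_lt ht y) _ h1 h2
  · intro x y h1 h2
    unfold tableSet at h1 h2
    have e1 := toNat_emod_add ht y 1
    have e2 := toNat_emod_add hs x 1
    rw [Nat.cast_one] at e1 e2
    rw [e1] at h1
    rw [e2] at h2
    exact hanti _ (toNat_emod_lt ht y) _ h1 h2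

theorem IsSpreadTable.mutualVisibilityNumber_eq {s₀ r : ℕ} (h : IsSpreadTable s₀ t r rows)
    (h₀ : 3 ≤ s₀) (ht : 3 ≤ t) (hr : r ≤ s₀) (hs : s₀ ≤ s) (hsr : s < 4 * r ∨ s₀ + 4 ≤ 4 * r) :
    mutualVisibilityNumber (cycleGraph s □ cycleGraph t) = 3 * t :=
  (h.isSpreadBase (by omega) (by omega) hr).mutualVisibilityNumber_eq h₀ ht hs (by omega)

/-- The rows consisting of `a`, `a + m₁` and `a + m₂` modulo `s`, for `a` in a list. -/
def shiftRows (s m₁ m₂ : ℕ) (l : List ℕ) : List (List ℕ) :=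
  l.map fun a => [a % s, (a + m₁) % s, (a + m₂) % s]

end table

/-! ### Verifying visibility by search -/

section search

/-- Backtracking search for a staircase from the origin to `(i, j)`, `i + j = n`, none of whose
inner points is blocked. -/
def staircaseSearch (blk : ℕ → ℕ → Bool) (n : ℕ) : ℕ → ℕ → Bool :=
  n.rec (fun _ _ => true) fun n r i j =>
    -- At total length one the predecessor is the origin, which is exempt from the obstacle test.
    -- Only predecessors are tested, so the far end is exempt too.
    n.casesOn true fun _ =>
      Bool.casesOn (motive := fun _ => Bool)
        (i.casesOn (motive := fun _ => Bool) false fun i' =>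
          Bool.casesOn (motive := fun _ => Bool) (blk i' j) (r i' j) false)
        (j.casesOn (motive := fun _ => Bool) false fun j' =>
          Bool.casesOn (motive := fun _ => Bool) (blk i j') (r i j') false)
        true

theorem staircaseSearch_succ_succ {blk : ℕ → ℕ → Bool} {n i j : ℕ}
    (h : staircaseSearch blk (n + 2) i j = true) :
    (∃ i', i = i' + 1 ∧ blk i' j = false ∧ staircaseSearch blk (n + 1) i' j = true) ∨
      ∃ j', j = j' + 1 ∧ blk i j' = false ∧ staircaseSearch blk (n + 1) i j' = true := by
  change Bool.casesOn (motive := fun _ => Bool)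
        (i.casesOn (motive := fun _ => Bool) false fun i' =>
          Bool.casesOn (motive := fun _ => Bool) (blk i' j) (staircaseSearch blk (n + 1) i' j) false)
        (j.casesOn (motive := fun _ => Bool) false fun j' =>
          Bool.casesOn (motive := fun _ => Bool) (blk i j') (staircaseSearch blk (n + 1) i j') false)
        true = true at h
  cases i with
  | zero =>
    cases j with
    | zero => simp at h
    | succ j' =>
      right
      cases hb : blk 0 j' with
      | true => simp [hb] at h
      | false => exact ⟨j', rfl, hb, by simpa [hb] using h⟩
  | succ i' =>
    cases hs : Bool.casesOn (motive := fun _ => Bool) (blk i' j)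
        (staircaseSearch blk (n + 1) i' j) false with
    | true =>
      left
      cases hb : blk i' j with
      | true => simp [hb] at hs
      | false => exact ⟨i', rfl, hb, by simpa [hb] using hs⟩
    | false =>
      right
      simp only [hs] at h
      cases j with
      | zero => simp at h
      | succ j' =>
        cases hb : blk (i' + 1) j' with
        | true => simp [hb] at h
        | false => exact ⟨j', rfl, hb, by simpa [hb] using h⟩

theorem exists_staircase_of_search {blk : ℕ → ℕ → Bool} {n i j : ℕ} (hij : i + j = n)
    (h : staircaseSearch blk n i j = true) :
    ∃ f : ℕ → ℕ, f 0 = 0 ∧ f n = j ∧ (∀ m < n, f (m + 1) = f m ∨ f (m + 1) = f m + 1) ∧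
      ∀ m, 0 < m → m < n → blk (m - f m) (f m) = false := by
  induction n generalizing i j with
  | zero => exact ⟨fun _ => 0, rfl, by simp; omega, by omega, by omega⟩
  | succ n ih =>
    cases n with
    | zero =>
      refine ⟨fun m => if m = 0 then 0 else j, rfl, by simp, ?_, by omega⟩
      intro m hm
      have : m = 0 := by omega
      subst this
      simp; omega
    | succ n =>
      have extend : ∀ i' j', i' + j' = n + 1 → (j = j' ∨ j = j' + 1) → blk i' j' = false →
          staircaseSearch blk (n + 1) i' j' = true →
          ∃ f : ℕ → ℕ, f 0 = 0 ∧ f (n + 1 + 1) = j ∧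
            (∀ m < n + 1 + 1, f (m + 1) = f m ∨ f (m + 1) = f m + 1) ∧
            ∀ m, 0 < m → m < n + 1 + 1 → blk (m - f m) (f m) = false := by
        intro i' j' hij' hj hb hs
        obtain ⟨f, f0, fn, fstep, ff⟩ := ih hij' hs
        refine ⟨fun m => if m ≤ n + 1 then f m else j, by simp [f0], by simp, ?_, ?_⟩
        · intro m hm
          rcases (show m < n + 1 ∨ m = n + 1 by omega) with h | rfl
          · simp only [show m ≤ n + 1 by omega, show m + 1 ≤ n + 1 by omega, if_true]
            exact fstep m h
          · simp only [le_refl, if_true, show ¬ n + 1 + 1 ≤ n + 1 by omega, if_false, fn]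
            exact hj
        · intro m hm0 hm
          simp only [show m ≤ n + 1 by omega, if_true]
          rcases (show m < n + 1 ∨ m = n + 1 by omega) with h | rfl
          · exact ff m hm0 h
          · rw [fn, show n + 1 - j' = i' by omega]
            exact hb
      rcases staircaseSearch_succ_succ h with ⟨i', rfl, hb, hs⟩ | ⟨j', rfl, hb, hs⟩
      · exact extend i' j (by omega) (Or.inl rfl) hb hs
      · exact extend i j' (by omega) (Or.inr rfl) hb hs

theorem MVisible.symm {V : Type*} {G : SimpleGraph V} {M : Set V} {u v : V}
    (h : MVisible G M u v) : MVisible G M v u := by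
  obtain ⟨p, hp, hl, hM⟩ := h
  refine ⟨p.reverse, hp.reverse, by rw [Walk.length_reverse, hl, dist_comm], ?_⟩
  intro w hw hwM
  rw [Walk.support_reverse, List.mem_reverse] at hw
  exact (hM w hw hwM).symm

/-- Search for a shortest path from `(a, y)` to a point of column `a'` that lies `q` rows
further. -/
def isVisible (s t : ℕ) (rows : List (List ℕ)) (a y a' q : ℕ) : Bool :=
  -- Both ways around each cycle are tried, subject to the half-period bound. The residues `s - 1`
  -- and `t - 1` stand for the direction `-1`, keeping the arithmetic in `ℕ`.
  [(1, (a' + s - a) % s), (s - 1, s - (a' + s - a) % s)].any fun x =>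
    (2 * x.2).ble s && [(1, q), (t - 1, t - q)].any fun z => (2 * z.2).ble t &&
      staircaseSearch (fun i j =>
        (rows.getD (((z.1.mul j).add y).mod t) []).any (((x.1.mul i).add a).mod s).beq)
        (x.2 + z.2) x.2 z.2

/-- All pairs of points of a table are visible. -/
def isVisibleTable (s t : ℕ) (rows : List (List ℕ)) : Bool :=
  -- Row offsets up to `t / 2` suffice, because visibility is symmetric.
  (List.range t).all fun y => (rows.getD y []).all fun a => (List.range (t / 2 + 1)).all fun q =>
    (rows.getD ((y + q) % t) []).all fun a' => isVisible s t rows a y a' q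

variable {s t : ℕ} [NeZero s] [NeZero t] {rows : List (List ℕ)}

theorem torusVertex_mem_latticeSet_tableSet {a y i j σ' τ' : ℕ} {σ τ : ℤ}
    (hσ : (σ' : ℤ) ≡ σ [ZMOD s]) (hτ : (τ' : ℤ) ≡ τ [ZMOD t])
    (h : torusVertex s t (a + σ * i) (y + τ * j) ∈ latticeSet s t (tableSet s t rows)) :
    (rows.getD (((τ'.mul j).add y).mod t) []).any (((σ'.mul i).add a).mod s).beq = true := by
  rw [torusVertex_mem_latticeSet tableSet_of_modEq] at h
  have h' : tableSet s t rows ((σ' * i + a : ℕ) : ℤ) ((τ' * j + y : ℕ) : ℤ) := by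
    refine tableSet_of_modEq ?_ ?_ h
    · push_cast
      rw [add_comm]
      exact (hσ.symm.mul_right _).add_right _
    · push_cast
      rw [add_comm]
      exact (hτ.symm.mul_right _).add_right _
  unfold tableSet at h'
  rw [List.any_eq_true]
  refine ⟨_, h', ?_⟩
  rw [Nat.beq_eq]
  norm_cast

theorem mVisible_of_isVisible (hs : 3 ≤ s) (ht : 3 ≤ t) {a y a' q : ℕ} (ha : a < s)
    (hq : q ≤ t) (h : isVisible s t rows a y a' q = true) :
    MVisible (cycleGraph s □ cycleGraph t) (latticeSet s t (tableSet s t rows))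
      (torusVertex s t a y) (torusVertex s t a' (y + q)) := by
  rw [isVisible, List.any_eq_true] at h
  obtain ⟨⟨σ', p⟩, hx, h⟩ := h
  rw [Bool.and_eq_true, List.any_eq_true, Nat.ble_eq] at h
  obtain ⟨hp, ⟨τ', q'⟩, hz, h⟩ := h
  rw [Bool.and_eq_true, Nat.ble_eq] at h
  obtain ⟨hq', h⟩ := h
  simp only at hp hq' h
  have hx' : ∃ σ : ℤ, (σ = 1 ∨ σ = -1) ∧ (σ' : ℤ) ≡ σ [ZMOD s] ∧ a + σ * p ≡ a' [ZMOD s] := by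
    have hr : ((((a' + s - a) % s : ℕ)) : ℤ) ≡ a' - a [ZMOD s] := by
      push_cast [Nat.cast_sub (show a ≤ a' + s by omega)]
      refine (Int.mod_modEq _ _).trans ?_
      rw [Int.modEq_iff_dvd]
      exact ⟨-1, by ring⟩
    have hlt : (a' + s - a) % s < s := Nat.mod_lt _ (by omega)
    simp only [List.mem_cons, Prod.mk.injEq, List.not_mem_nil, or_false] at hx
    rcases hx with ⟨rfl, rfl⟩ | ⟨rfl, rfl⟩
    · refine ⟨1, Or.inl rfl, by simp, ?_⟩
      have := hr.add_left (a : ℤ)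
      simpa using this
    · refine ⟨-1, Or.inr rfl, ?_, ?_⟩
      · rw [Int.modEq_iff_dvd]
        exact ⟨-1, by push_cast [Nat.cast_sub (show 1 ≤ s by omega)]; ring⟩
      · rw [Nat.cast_sub hlt.le]
        have h1 := (hr.add_left (a : ℤ)).sub_right (s : ℤ)
        have h2 : (a : ℤ) + (a' - a) - s ≡ a' [ZMOD s] := by
          rw [Int.modEq_iff_dvd]; exact ⟨1, by ring⟩
        have h3 := h1.trans h2
        convert h3 using 1
        ring
  have hz' : ∃ τ : ℤ, (τ = 1 ∨ τ = -1) ∧ (τ' : ℤ) ≡ τ [ZMOD t] ∧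
      y + τ * q' ≡ y + q [ZMOD t] := by
    simp only [List.mem_cons, Prod.mk.injEq, List.not_mem_nil, or_false] at hz
    rcases hz with ⟨rfl, rfl⟩ | ⟨rfl, rfl⟩
    · exact ⟨1, Or.inl rfl, by simp, by simp⟩
    · refine ⟨-1, Or.inr rfl, ?_, ?_⟩
      · rw [Int.modEq_iff_dvd]
        exact ⟨-1, by push_cast [Nat.cast_sub (show 1 ≤ t by omega)]; ring⟩
      · rw [Nat.cast_sub hq, Int.modEq_iff_dvd]
        exact ⟨1, by ring⟩
  obtain ⟨σ, hσ, hσ', hend⟩ := hx'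
  obtain ⟨τ, hτ, hτ', hend'⟩ := hz'
  obtain ⟨f, f0, fn, fstep, ff⟩ := exists_staircase_of_search rfl h
  have hle : ∀ n ≤ p + q', f n ≤ n := by
    intro n
    induction n with
    | zero => simp [f0]
    | succ n ih =>
      intro hn
      have := ih (by omega)
      rcases fstep n (by omega) with e | e <;> omega
  have hvis := mVisible_of_staircase (M := latticeSet s t (tableSet s t rows)) hs ht a y hσ hτ hp
    hq' f f0 fn fstep (by
      intro n hn0 hn hmem
      have h1 := ff n hn0 hn
      rw [← Nat.cast_sub (hle n hn.le)] at hmem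
      have h2 := torusVertex_mem_latticeSet_tableSet hσ' hτ' hmem
      exact Bool.false_ne_true (h1.symm.trans h2))
  have e : torusVertex s t (a + σ * p) (y + τ * q') = torusVertex s t a' (y + q) :=
    Prod.ext (cycleVertex_eq_iff.2 hend) (cycleVertex_eq_iff.2 hend')
  rwa [e] at hvis

theorem mVisible_of_isVisibleTable (hs : 3 ≤ s) (ht : 3 ≤ t) (h : isVisibleTable s t rows = true)
    {u v : Fin s × Fin t} (hu : u ∈ latticeSet s t (tableSet s t rows))
    (hv : v ∈ latticeSet s t (tableSet s t rows)) {q : ℕ} (hq : 2 * q ≤ t)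
    (hvu : v.2.val = (u.2.val + q) % t) :
    MVisible (cycleGraph s □ cycleGraph t) (latticeSet s t (tableSet s t rows)) u v := by
  have hu' : u.1.val ∈ rows.getD u.2.val [] := (tableSet_natCast u.1.isLt u.2.isLt).1 hu
  have hv' : v.1.val ∈ rows.getD v.2.val [] := (tableSet_natCast v.1.isLt v.2.isLt).1 hv
  rw [hvu] at hv'
  simp only [isVisibleTable, List.all_eq_true, List.mem_range] at h
  have h1 := mVisible_of_isVisible hs ht u.1.isLt (by omega)
    (h _ u.2.isLt _ hu' q (by omega) _ hv')
  have e : torusVertex s t v.1.val ((u.2.val : ℤ) + q) = v := by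
    refine Prod.ext (cycleVertex_coe _) ?_
    rw [← cycleVertex_coe v.2, torusVertex, cycleVertex_eq_iff, hvu]
    push_cast
    exact (Int.mod_modEq _ _).symm
  rwa [torusVertex_coe, e] at h1

theorem isMutualVisibilitySet_tableSet (hs : 3 ≤ s) (ht : 3 ≤ t)
    (h : isVisibleTable s t rows = true) :
    IsMutualVisibilitySet (cycleGraph s □ cycleGraph t) (latticeSet s t (tableSet s t rows)) := by
  intro u hu v hv
  have h1 := u.2.isLt
  have h2 := v.2.isLt
  have key : ∀ {u v : Fin s × Fin t}, u ∈ latticeSet s t (tableSet s t rows) →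
      v ∈ latticeSet s t (tableSet s t rows) → u.2.val ≤ v.2.val →
      MVisible (cycleGraph s □ cycleGraph t) (latticeSet s t (tableSet s t rows)) u v := by
    intro u v hu hv huv
    have h1 := u.2.isLt
    have h2 := v.2.isLt
    rcases le_total (2 * (v.2.val - u.2.val)) t with h3 | h3
    · refine mVisible_of_isVisibleTable hs ht h hu hv h3 ?_
      rw [Nat.mod_eq_of_lt (by omega)]; omega
    · refine (mVisible_of_isVisibleTable hs ht h hv hu (q := t - (v.2.val - u.2.val)) (by omega)
        ?_).symm
      rw [show v.2.val + (t - (v.2.val - u.2.val)) = u.2.val + t by omega, Nat.add_mod_right,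
        Nat.mod_eq_of_lt h1]
  rcases le_total u.2.val v.2.val with h3 | h3
  · exact key hu hv h3
  · exact (key hv hu h3).symm

end search

/-! ### The small values of `t` -/

theorem mutualVisibilityNumber_of_isVisibleTable {s t : ℕ} {rows : List (List ℕ)} (hs : 3 ≤ s)
    (ht : 3 ≤ t) (h3 : IsTripleTable s t rows) (h : isVisibleTable s t rows = true) :
    mutualVisibilityNumber (cycleGraph s □ cycleGraph t) = 3 * t := by
  have : NeZero s := ⟨by omega⟩
  have : NeZero t := ⟨by omega⟩
  exact mutualVisibilityNumber_eq_of_exists hs (isMutualVisibilitySet_tableSet hs ht h)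
    (le_ncard_latticeSet tableSet_of_modEq (h3.exists_three (by omega) (by omega)))

/-- One spread table on a cycle of length 18, with row gaps 6, has enough slack (`18 + 4 ≤ 4 * 6`)
to be stretched to all `s ≥ 18`. The tables for the shorter cycles need not be spread and are
checked pair by pair. -/
theorem mutualVisibilityNumber_twelve {s : ℕ} (hs : 12 ≤ s) :
    mutualVisibilityNumber (cycleGraph s □ cycleGraph 12) = 3 * 12 := by
  rcases le_or_gt 18 s with h | h
  · exact IsSpreadTable.mutualVisibilityNumber_eq (s₀ := 18) (r := 6)
      (rows := shiftRows 18 6 12 [0, 2, 4, 1, 3, 5, 2, 0, 4, 1, 5, 3])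
      (by decide +kernel) (by omega) (by omega) (by omega) h (by omega)
  obtain rfl | rfl | rfl | rfl | rfl | rfl :
      s = 12 ∨ s = 13 ∨ s = 14 ∨ s = 15 ∨ s = 16 ∨ s = 17 := by omega
  · exact mutualVisibilityNumber_of_isVisibleTable
      (rows := shiftRows 12 4 8 [0, 10, 9, 3, 0, 10, 9, 11, 2, 0, 1, 11])
      (by omega) (by omega) (by decide +kernel) (by decide +kernel)
  · exact mutualVisibilityNumber_of_isVisibleTable
      (rows := shiftRows 13 4 8 [0, 1, 3, 0, 2, 1, 3, 0, 2, 1, 3, 2])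
      (by omega) (by omega) (by decide +kernel) (by decide +kernel)
  · exact mutualVisibilityNumber_of_isVisibleTable
      (rows := shiftRows 14 4 8 [0, 1, 3, 0, 2, 1, 3, 0, 2, 1, 3, 2])
      (by omega) (by omega) (by decide +kernel) (by decide +kernel)
  · exact mutualVisibilityNumber_of_isVisibleTable
      (rows := shiftRows 15 5 10 [0, 14, 13, 11, 14, 13, 12, 10, 14, 13, 11, 12])
      (by omega) (by omega) (by decide +kernel) (by decide +kernel)
  · exact mutualVisibilityNumber_of_isVisibleTable
      (rows := shiftRows 16 5 10 [0, 13, 12, 14, 15, 11, 13, 14, 15, 12, 14, 15])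
      (by omega) (by omega) (by decide +kernel) (by decide +kernel)
  · exact mutualVisibilityNumber_of_isVisibleTable
      (rows := shiftRows 17 5 10 [0, 14, 8, 5, 4, 7, 1, 4, 12, 15, 13, 16])
      (by omega) (by omega) (by decide +kernel) (by decide +kernel)

theorem mutualVisibilityNumber_fourteen {s : ℕ} (hs : 14 ≤ s) :
    mutualVisibilityNumber (cycleGraph s □ cycleGraph 14) = 3 * 14 := by
  rcases le_or_gt 18 s with h | h
  · exact IsSpreadTable.mutualVisibilityNumber_eq (s₀ := 18) (r := 6)
      (rows := shiftRows 18 6 12 [0, 2, 4, 1, 3, 0, 2, 4, 1, 3, 0, 2, 5, 3])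
      (by decide +kernel) (by omega) (by omega) (by omega) h (by omega)
  obtain rfl | rfl | rfl | rfl : s = 14 ∨ s = 15 ∨ s = 16 ∨ s = 17 := by omega
  · exact mutualVisibilityNumber_of_isVisibleTable
      (rows := [[4, 8, 11], [2, 6, 12], [0, 5, 10], [1, 7, 11], [3, 9, 13], [2, 6, 12], [0, 4, 8],
        [1, 5, 10], [3, 9, 13], [4, 7, 11], [1, 8, 12], [2, 6, 10], [0, 5, 9], [3, 7, 13]])
      (by omega) (by omega) (by decide +kernel) (by decide +kernel)
  · exact mutualVisibilityNumber_of_isVisibleTable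
      (rows := shiftRows 15 5 10 [0, 12, 1, 3, 0, 14, 11, 10, 12, 13, 14, 11, 13, 14])
      (by omega) (by omega) (by decide +kernel) (by decide +kernel)
  · exact mutualVisibilityNumber_of_isVisibleTable
      (rows := shiftRows 16 5 10 [0, 13, 12, 14, 13, 15, 12, 11, 13, 14, 11, 12, 14, 15])
      (by omega) (by omega) (by decide +kernel) (by decide +kernel)
  · exact IsSpreadTable.mutualVisibilityNumber_eq (s₀ := 17) (r := 5)
      (rows := shiftRows 17 5 10 [0, 14, 11, 8, 5, 2, 16, 13, 15, 12, 14, 16, 13, 15])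
      (by decide +kernel) (by omega) (by omega) (by omega) (by omega) (by omega)

theorem mutualVisibilityNumber_sixteen {s : ℕ} (hs : 16 ≤ s) :
    mutualVisibilityNumber (cycleGraph s □ cycleGraph 16) = 3 * 16 := by
  rcases le_or_gt 18 s with h | h
  · exact IsSpreadTable.mutualVisibilityNumber_eq (s₀ := 18) (r := 6)
      (rows := shiftRows 18 6 12 [0, 2, 4, 1, 3, 0, 2, 4, 1, 3, 0, 2, 4, 1, 5, 3])
      (by decide +kernel) (by omega) (by omega) (by omega) h (by omega)
  obtain rfl | rfl : s = 16 ∨ s = 17 := by omega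
  · exact mutualVisibilityNumber_of_isVisibleTable
      (rows := shiftRows 16 5 10 [0, 1, 15, 14, 11, 12, 13, 10, 9, 6, 7, 8, 5, 4, 2, 3])
      (by omega) (by omega) (by decide +kernel) (by decide +kernel)
  · exact IsSpreadTable.mutualVisibilityNumber_eq (s₀ := 17) (r := 5)
      (rows := shiftRows 17 5 10 [0, 2, 4, 6, 8, 10, 12, 14, 16, 13, 15, 12, 14, 16, 13, 15])
      (by decide +kernel) (by omega) (by omega) (by omega) (by omega) (by omega)

theorem mutualVisibilityNumber_seventeen {s : ℕ} (hs : 17 ≤ s) :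
    mutualVisibilityNumber (cycleGraph s □ cycleGraph 17) = 3 * 17 := by
  rcases le_or_gt 18 s with h | h
  · exact IsSpreadTable.mutualVisibilityNumber_eq (s₀ := 18) (r := 6)
      (rows := shiftRows 18 6 12 [0, 2, 4, 1, 3, 0, 2, 4, 1, 3, 5, 2, 0, 4, 1, 5, 3])
      (by decide +kernel) (by omega) (by omega) (by omega) h (by omega)
  · exact IsSpreadTable.mutualVisibilityNumber_eq (s₀ := 17) (r := 5)
      (rows := shiftRows 17 5 10 [0, 2, 4, 6, 8, 10, 12, 14, 16, 1, 3, 5, 7, 9, 11, 13, 15])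
      (by decide +kernel) (by omega) (by omega) (by omega) hs (by omega)

theorem mutualVisibilityNumber_eighteen {s : ℕ} (hs : 18 ≤ s) :
    mutualVisibilityNumber (cycleGraph s □ cycleGraph 18) = 3 * 18 :=
  IsSpreadTable.mutualVisibilityNumber_eq (s₀ := 18) (r := 6)
    (rows := shiftRows 18 6 12 [0, 2, 4, 1, 3, 5, 2, 0, 4, 1, 3, 5, 2, 0, 4, 1, 5, 3])
    (by decide +kernel) (by omega) (by omega) (by omega) hs (by omega)

theorem mutualVisibilityNumber_twenty {s : ℕ} (hs : 20 ≤ s) :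
    mutualVisibilityNumber (cycleGraph s □ cycleGraph 20) = 3 * 20 := by
  rcases hs.eq_or_lt with rfl | h
  · exact mutualVisibilityNumber_of_isVisibleTable
      (rows := shiftRows 20 5 12
        [0, 1, 19, 17, 18, 16, 14, 15, 13, 12, 10, 11, 9, 7, 5, 8, 6, 4, 2, 3])
      (by omega) (by omega) (by decide +kernel) (by decide +kernel)
  · exact IsSpreadTable.mutualVisibilityNumber_eq (s₀ := 21) (r := 7)
      (rows := shiftRows 21 7 14
        [0, 2, 4, 1, 3, 5, 0, 2, 4, 1, 6, 3, 0, 5, 2, 4, 1, 6, 3, 5])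
      (by decide +kernel) (by omega) (by omega) (by omega) h (by omega)

theorem mutualVisibilityNumber_twentyTwo {s : ℕ} (hs : 22 ≤ s) :
    mutualVisibilityNumber (cycleGraph s □ cycleGraph 22) = 3 * 22 := by
  rcases le_or_gt 24 s with h | h
  · exact IsSpreadTable.mutualVisibilityNumber_eq (s₀ := 24) (r := 8)
      (rows := shiftRows 24 8 16
        [0, 2, 4, 1, 3, 5, 0, 2, 4, 1, 3, 5, 7, 2, 0, 6, 1, 4, 7, 5, 3, 6])
      (by decide +kernel) (by omega) (by omega) (by omega) h (by omega)
  -- Only `s = 22` and `s = 23` remain, where `s < 4 * 6` holds outright and no stretching slack is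
  -- needed.
  · exact IsSpreadTable.mutualVisibilityNumber_eq (s₀ := 22) (r := 6)
      (rows := [[6, 12, 18], [3, 10, 16], [0, 8, 14], [2, 11, 17], [4, 13, 20], [1, 7, 15],
        [5, 12, 21], [3, 9, 19], [0, 6, 16], [2, 8, 18], [4, 10, 20], [1, 7, 17], [5, 14, 21],
        [3, 11, 19], [0, 6, 13], [2, 9, 15], [4, 12, 18], [1, 10, 16], [8, 14, 20], [5, 11, 17],
        [7, 13, 19], [9, 15, 21]])
      (by decide +kernel) (by omega) (by omega) (by omega) hs (by omega)

theorem theorem2 (s t : ℕ) (ht : 14 ≤ t ∨ t = 12) (hst : t ≤ s) :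
    mutualVisibilityNumber (cycleGraph s □ cycleGraph t) = 3 * t := by
  by_cases h12 : t = 12
  · subst h12; exact mutualVisibilityNumber_twelve hst
  by_cases h14 : t = 14
  · subst h14; exact mutualVisibilityNumber_fourteen hst
  by_cases h16 : t = 16
  · subst h16; exact mutualVisibilityNumber_sixteen hst
  by_cases h17 : t = 17
  · subst h17; exact mutualVisibilityNumber_seventeen hst
  by_cases h18 : t = 18
  · subst h18; exact mutualVisibilityNumber_eighteen hst
  by_cases h20 : t = 20
  · subst h20; exact mutualVisibilityNumber_twenty hst
  by_cases h22 : t = 22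
  · subst h22; exact mutualVisibilityNumber_twentyTwo hst
  by_cases hsp : t = 19 ∨ t = 25 ∨ t = 26 ∨ t = 34 ∨ t = 38
  · exact mutualVisibilityNumber_of_mem_sporadic hst hsp
  rcases (by omega : t % 2 = 1 ∨ t % 4 = 0 ∨ t % 4 = 2) with h | h | h
  · exact mutualVisibilityNumber_of_odd hst h (by omega) h17 (by omega) (by omega)
  · exact mutualVisibilityNumber_of_mod_four_eq_zero hst h (by omega)
  · exact mutualVisibilityNumber_of_mod_four_eq_two hst h (by omega) (by omega) (by omega)
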